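/- Let $\mathbb F$ be a field. For an integer $n\ge 0$ let $N_n$ be the nilcoxeter algebra: the unital $\mathbb F$-algebra generated by $u_1,\dots,u_{n-1}$ subject to $u_i^2=0$, $u_iu_j=u_ju_i$ for $|i-j|>1$, and $u_iu_{i+1}u_i=u_{i+1}u_iu_{i+1}$ (so $N_0=N_1=\mathbb F$). It is a $\mathbb Z\times\mathbb Z_2$-graded superalgebra with every $u_i$ of degree $(1,1)$; write $\bar x$ for the $\mathbb Z_2$-degree (parity) of a homogeneous $x$. In the formulas below all elements $a_i,a,b,x$ are homogeneous. A *Frobenius graded superalgebra of degree $d$* is a finite-dimensional graded superalgebra $A$ with a linear map $\mathrm{tr}\colon A\to\mathbb F$ of degree $d$ ($\mathbb F$ being in degree $0$) whose kernel contains no nonzero left ideal; its *Nakayama automorphism* is the algebra automorphism $\psi$ with $\mathrm{tr}(a_1a_2)=(-1)^{\bar a_1\bar a_2}\,\mathrm{tr}(a_2\psi(a_1))$. Let $A$ be a graded superring with graded sub-superring $B$, and let $\alpha,\beta$ be automorphisms of $A$, $B$ as graded superrings. Then $A$ is an *$(\alpha,\beta)$-Frobenius extension of $B$ of degree $(-\lambda,\pi)$*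 if $A$ is finitely generated and projective as a left $B$-module and there is an isomorphism of graded $(A,B)$-bimodules $A\cong \mathrm{HOM}_B(A,\{\lambda,\pi\}B)$. Here $\{\lambda,\pi\}B$ is $B$ with grading $(\{\lambda,\pi\}B)_{\nu,\delta}=B_{\nu-\lambda,\delta+\pi}$ and left action $b\cdot y=(-1)^{\pi\bar b}by$; $\mathrm{HOM}_B$ is the direct sum over $(\mu,\gamma)$ of the groups of additive maps $f$ of degree $(\mu,\gamma)$ with $f(\beta(b)x)=(-1)^{\gamma\bar b}\,b\cdot f(x)$; and its bimodule structure is $(a\cdot f)(x)=(-1)^{\bar a\bar f+\bar a\bar x}f(x\alpha(a))$, $(f\cdot b)(x)=(-1)^{\bar b\bar x}f(x)b$. 1. For every $n\ge0$, $N_n$ is a Frobenius graded superalgebra of degree $\left(-\binom n2,\binom n2\right)$, with Nakayama automorphism $\psi_n$ given by $\psi_n(u_i)=(-1)^{\binom n2-1}u_{n-i}$. 2. If $0\le m<n$, then via the canonical injection $N_m\hookrightarrow N_n$, $u_i\mapsto u_i$, the algebra $N_n$ is a $(\psi_n,\psi_m)$-Frobenius extension of $N_m$ of degree $\left(\binom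 m2-\binom n2,\ \binom m2+\binom n2\right)$. 3. If $2\le m<n$, then for no graded superring automorphism $\beta$ of $N_m$ is $N_n$ an $(\mathrm{id},\beta)$-Frobenius extension of $N_m$, of any degree. -/

import Mathlib

open scoped DirectSum

/-! ## Graded superrings

A graded superring is a ring graded by `Λ × ZMod 2`, where `Λ` is an abelian group. -/

namespace GradedSuper

section Extension

variable {Λ : Type*} [AddCommGroup Λ] [DecidableEq Λ]
variable {A B σ τ : Type*} [Ring A] [Ring B]
variable [SetLike σ A] [AddSubgroupClass σ A] [SetLike τ B] [AddSubgroupClass τ B]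

/-- An automorphism of a graded superring: a ring automorphism preserving degrees. (Since `A` is
the direct sum of its homogeneous components, the inverse then preserves degrees as well.) -/
structure GradedAut (𝒜 : Λ × ZMod 2 → σ) [GradedRing 𝒜] extends A ≃+* A where
  map_mem' : ∀ (p : Λ × ZMod 2) (a : A), a ∈ 𝒜 p → toFun a ∈ 𝒜 p

instance (𝒜 : Λ × ZMod 2 → σ) [GradedRing 𝒜] : CoeFun (GradedAut 𝒜) (fun _ => A → A) where
  coe α := α.toRingEquiv

/-- The identity automorphism of a graded superring. -/
def GradedAut.id (𝒜 : Λ × ZMod 2 → σ) [GradedRing 𝒜] : GradedAut 𝒜 where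
  toRingEquiv := RingEquiv.refl A
  map_mem' _ _ h := h

/-- The homogeneous component of degree `p` of the shift `{lam, π} B`, that is
`({lam, π} B)_{ν, δ} = B_{ν - lam, δ + π}`. -/
def shift (ℬ : Λ × ZMod 2 → τ) (lam : Λ) (π : ZMod 2) (p : Λ × ZMod 2) : τ :=
  ℬ (p.1 - lam, p.2 + π)

/-- The left action on the shift `{lam, π} B` of an element `b` of parity `γ`:
`b · {lam, π} y = (-1) ^ (π γ) {lam, π} (b y)`. -/
def shiftAct (π γ : ZMod 2) (b y : B) : B :=
  ((-1 : ℤˣ) ^ (π * γ)) • (b * y)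

variable (𝒜 : Λ × ZMod 2 → σ) (ℬ : Λ × ZMod 2 → τ) [GradedRing 𝒜] [GradedRing ℬ]

/-- The homogeneous component of degree `p` of `HOM_B^L(^β_B A, {lam, π} B)`: the additive maps `f`
which are homogeneous of degree `p` and satisfy `f (b · x) = (-1) ^ (p.2 * |b|) b · f x` for all
homogeneous `b`, where `b · x = β(b) x` on `^β_B A` and the action on the right-hand side is that
of the shift. Here `B` acts on `A` through `ι`. -/
def homComponent (ι : GradedRingHom ℬ 𝒜) (β : GradedAut ℬ) (lam : Λ) (π : ZMod 2)
    (p : Λ × ZMod 2) : AddSubgroup (A →+ B) where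
  carrier := {f |
    (∀ (q : Λ × ZMod 2) (x : A), x ∈ 𝒜 q → f x ∈ shift ℬ lam π (p + q)) ∧
    (∀ (q : Λ × ZMod 2) (b : B), b ∈ ℬ q → ∀ x : A,
      f (ι (β b) * x) = ((-1 : ℤˣ) ^ (p.2 * q.2)) • shiftAct π q.2 b (f x))}
  zero_mem' := ⟨fun _ _ _ => zero_mem _, fun _ _ _ _ => by simp [shiftAct]⟩
  add_mem' hf hg := ⟨fun q x hx => add_mem (hf.1 q x hx) (hg.1 q x hx), fun q b hb x => by
    simp only [AddMonoidHom.add_apply, hf.2 q b hb x, hg.2 q b hb x, shiftAct, mul_add, smul_add]⟩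
  neg_mem' hf := ⟨fun q x hx => neg_mem (hf.1 q x hx), fun q b hb x => by
    simp only [AddMonoidHom.neg_apply, hf.2 q b hb x, shiftAct, mul_neg, smul_neg]⟩

/-- `HOM_B^L(^β_B A, {lam, π} B)`, the (direct) sum of its homogeneous components. -/
def HOM (ι : GradedRingHom ℬ 𝒜) (β : GradedAut ℬ) (lam : Λ) (π : ZMod 2) :
    AddSubgroup (A →+ B) :=
  ⨆ p : Λ × ZMod 2, homComponent 𝒜 ℬ ι β lam π p

/-- `A` is an `(α, β)`-Frobenius extension of `B` of degree `deg = (-lam, π)`, where the graded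
superring `B` is regarded as a graded sub-superring of `A` through the injection `ι`:
`A` is a finitely generated projective left `B`-module, and there is an isomorphism
`Φ : A ≅ HOM_B^L(^β A ^α, {lam, π} B)` of graded `(A, B)`-bimodules. The actions on the
right-hand side are, for `f` of parity `δ`, `a ∈ A` of parity `γ`, `b ∈ B` of parity `γ`, and `x`
of parity `ε`:
`(a · f) x = (-1) ^ (γ δ) (-1) ^ (γ ε) f (x α(a))`;
`(f · b) x = (-1) ^ (γ δ) (-1) ^ (γ (δ + ε)) (f x) b`, where `δ + ε` is the parity of `f x` as an
element of `{lam, π} B`. -/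
structure IsTwistedFrobeniusExtension (ι : GradedRingHom ℬ 𝒜) (α : GradedAut 𝒜)
    (β : GradedAut ℬ) (deg : Λ × ZMod 2) : Prop where
  injective : Function.Injective ι
  finite : letI : Module B A := Module.compHom A (ι : B →+* A); Module.Finite B A
  projective : letI : Module B A := Module.compHom A (ι : B →+* A); Module.Projective B A
  exists_iso : ∃ Φ : A ≃+ HOM 𝒜 ℬ ι β (-deg.1) deg.2,
    (∀ (p : Λ × ZMod 2) (a : A), a ∈ 𝒜 p →
      (Φ a : A →+ B) ∈ homComponent 𝒜 ℬ ι β (-deg.1) deg.2 p) ∧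
    (∀ (p q r : Λ × ZMod 2) (a y x : A), a ∈ 𝒜 p → y ∈ 𝒜 q → x ∈ 𝒜 r →
      (Φ (a * y) : A →+ B) x =
        ((-1 : ℤˣ) ^ (p.2 * q.2)) • ((-1 : ℤˣ) ^ (p.2 * r.2)) • (Φ y : A →+ B) (x * α a)) ∧
    (∀ (p q r : Λ × ZMod 2) (b : B) (y x : A), b ∈ ℬ p → y ∈ 𝒜 q → x ∈ 𝒜 r →
      (Φ (y * ι b) : A →+ B) x =
        ((-1 : ℤˣ) ^ (p.2 * q.2)) • ((-1 : ℤˣ) ^ (p.2 * (q.2 + r.2))) • ((Φ y : A →+ B) x * b))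

end Extension

section FrobeniusAlgebra

variable {Λ : Type*} [AddCommGroup Λ] [DecidableEq Λ]
variable {F A : Type*} [Field F] [Ring A] [Algebra F A]

/-- `tr` is a trace map making the graded superalgebra `A` a Frobenius graded superalgebra of
degree `deg`: `A` is finite dimensional, `tr` is homogeneous of degree `deg` (with `F` concentrated
in degree zero), and the kernel of `tr` contains no nonzero left ideal. -/
structure IsFrobeniusTrace (𝒜 : Λ × ZMod 2 → Submodule F A) [GradedAlgebra 𝒜]
    (deg : Λ × ZMod 2) (tr : A →ₗ[F] F) : Prop where
  finite : FiniteDimensional F A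
  homogeneous : ∀ (p : Λ × ZMod 2) (a : A), a ∈ 𝒜 p → deg + p ≠ 0 → tr a = 0
  nondegenerate : ∀ I : Ideal A, (∀ a ∈ I, tr a = 0) → I = ⊥

/-- `ψ` is the Nakayama automorphism corresponding to the trace map `tr`:
`tr (a₁ a₂) = (-1) ^ (|a₁| |a₂|) tr (a₂ ψ(a₁))` for homogeneous `a₁`, `a₂`. -/
def IsNakayama (𝒜 : Λ × ZMod 2 → Submodule F A) [GradedAlgebra 𝒜]
    (tr : A →ₗ[F] F) (ψ : A ≃ₐ[F] A) : Prop :=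
  ∀ (p q : Λ × ZMod 2) (a₁ a₂ : A), a₁ ∈ 𝒜 p → a₂ ∈ 𝒜 q →
    tr (a₁ * a₂) = ((-1 : ℤˣ) ^ (p.2 * q.2)) • tr (a₂ * ψ a₁)

end FrobeniusAlgebra

end GradedSuper

/-! ## Nilcoxeter algebras -/

/-- The defining relations of the nilcoxeter algebra `N_n`. The index `i : Fin (n - 1)` stands for
the generator `u_{i+1}`. -/
inductive NilcoxeterRel (F : Type*) [Field F] (n : ℕ) :
    FreeAlgebra F (Fin (n - 1)) → FreeAlgebra F (Fin (n - 1)) → Prop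
  | sq (i : Fin (n - 1)) :
      NilcoxeterRel F n (FreeAlgebra.ι F i * FreeAlgebra.ι F i) 0
  | comm (i j : Fin (n - 1)) (h : i.val + 1 < j.val ∨ j.val + 1 < i.val) :
      NilcoxeterRel F n (FreeAlgebra.ι F i * FreeAlgebra.ι F j)
        (FreeAlgebra.ι F j * FreeAlgebra.ι F i)
  | braid (i j : Fin (n - 1)) (h : i.val + 1 = j.val) :
      NilcoxeterRel F n (FreeAlgebra.ι F i * FreeAlgebra.ι F j * FreeAlgebra.ι F i)
        (FreeAlgebra.ι F j * FreeAlgebra.ι F i * FreeAlgebra.ι F j)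

/-- The nilcoxeter algebra `N_n` over `F`; it has no generators, and so is `F`, for `n = 0, 1`. -/
def Nilcoxeter (F : Type*) [Field F] (n : ℕ) : Type _ := RingQuot (NilcoxeterRel F n)

namespace Nilcoxeter

variable (F : Type*) [Field F] (n : ℕ)

instance : Ring (Nilcoxeter F n) := inferInstanceAs (Ring (RingQuot (NilcoxeterRel F n)))

instance : Algebra F (Nilcoxeter F n) :=
  inferInstanceAs (Algebra F (RingQuot (NilcoxeterRel F n)))

/-- The generators of `N_n`: `u F n i` is `u_{i+1}`. -/
def u (i : Fin (n - 1)) : Nilcoxeter F n :=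
  RingQuot.mkAlgHom F (NilcoxeterRel F n) (FreeAlgebra.ι F i)

theorem u_sq (i : Fin (n - 1)) : u F n i * u F n i = 0 := by
  have h := RingQuot.mkAlgHom_rel F (NilcoxeterRel.sq (F := F) i)
  rw [map_mul, map_zero] at h
  exact h

theorem u_comm (i j : Fin (n - 1)) (hij : i.val + 1 < j.val ∨ j.val + 1 < i.val) :
    u F n i * u F n j = u F n j * u F n i := by
  have h := RingQuot.mkAlgHom_rel F (NilcoxeterRel.comm (F := F) i j hij)
  rw [map_mul, map_mul] at h
  exact h

theorem u_braid (i j : Fin (n - 1)) (hij : i.val + 1 = j.val) :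
    u F n i * u F n j * u F n i = u F n j * u F n i * u F n j := by
  have h := RingQuot.mkAlgHom_rel F (NilcoxeterRel.braid (F := F) i j hij)
  simp only [map_mul] at h
  exact h

variable {F n}

/-- The universal property of `N_n`. -/
def lift {A : Type*} [Ring A] [Algebra F A] (f : Fin (n - 1) → A)
    (hsq : ∀ i, f i * f i = 0)
    (hcomm : ∀ i j : Fin (n - 1), (i.val + 1 < j.val ∨ j.val + 1 < i.val) → f i * f j = f j * f i)
    (hbraid : ∀ i j : Fin (n - 1), i.val + 1 = j.val → f i * f j * f i = f j * f i * f j) :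
    Nilcoxeter F n →ₐ[F] A :=
  RingQuot.liftAlgHom F ⟨FreeAlgebra.lift F f, by
    intro x y h
    cases h with
    | sq i => simpa using hsq i
    | comm i j h => simpa using hcomm i j h
    | braid i j h => simpa using hbraid i j h⟩

theorem lift_u {A : Type*} [Ring A] [Algebra F A] (f : Fin (n - 1) → A) (hsq hcomm hbraid)
    (i : Fin (n - 1)) : lift (F := F) f hsq hcomm hbraid (u F n i) = f i := by
  unfold lift u
  exact (RingQuot.liftAlgHom_mkAlgHom_apply _ _ _ _).trans (FreeAlgebra.lift_ι_apply _ _)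

theorem hom_ext {A : Type*} [Ring A] [Algebra F A] {f g : Nilcoxeter F n →ₐ[F] A}
    (h : ∀ i, f (u F n i) = g (u F n i)) : f = g := by
  apply RingQuot.ringQuot_ext'
  apply FreeAlgebra.hom_ext
  funext i
  exact h i

variable (F n)

/-- The grading of `N_n` by `ℤ × ZMod 2` with every generator in degree `(1, 1)`: the component of
degree `p` is spanned by the words in the generators whose length `k` satisfies `(k, k) = p`. -/
def grading (p : ℤ × ZMod 2) : Submodule F (Nilcoxeter F n) :=
  Submodule.span F {x | ∃ l : List (Fin (n - 1)),
    ((l.length : ℤ), (l.length : ZMod 2)) = p ∧ (l.map (u F n)).prod = x}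

theorem u_mem (i : Fin (n - 1)) : u F n i ∈ grading F n (1, 1) :=
  Submodule.subset_span ⟨[i], by simp, by simp⟩

instance : SetLike.GradedMonoid (grading F n) where
  one_mem := Submodule.subset_span ⟨[], by simp [Prod.ext_iff], by simp⟩
  mul_mem p q x y hx hy := by
    have h : grading F n p * grading F n q ≤ grading F n (p + q) := by
      unfold grading
      rw [Submodule.span_mul_span]
      apply Submodule.span_mono
      rintro _ ⟨_, ⟨l, hl, rfl⟩, _, ⟨k, hk, rfl⟩, rfl⟩
      refine ⟨l ++ k, ?_, by simp⟩
      rw [← hl, ← hk]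
      simp
    exact h (Submodule.mul_mem_mul hx hy)

/-- The generator `u F n i` as an element of the direct sum of the components. -/
def uDirect (i : Fin (n - 1)) : ⨁ p, grading F n p :=
  DirectSum.of (fun p => grading F n p) (1, 1) ⟨u F n i, u_mem F n i⟩

/-- The decomposition of `N_n` into its homogeneous components. -/
def decomposeHom : Nilcoxeter F n →ₐ[F] ⨁ p, grading F n p :=
  lift (uDirect F n)
    (fun i => by
      unfold uDirect
      rw [DirectSum.of_mul_of]
      exact (congrArg (DirectSum.of (fun p => grading F n p) _) (Subtype.ext (u_sq F n i))).trans
        (map_zero _))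
    (fun i j h => by
      unfold uDirect
      rw [DirectSum.of_mul_of, DirectSum.of_mul_of]
      congr 1
      exact Subtype.ext (u_comm F n i j h))
    (fun i j h => by
      unfold uDirect
      simp only [DirectSum.of_mul_of]
      congr 1
      exact Subtype.ext (u_braid F n i j h))

theorem decomposeHom_word (l : List (Fin (n - 1))) (p : ℤ × ZMod 2)
    (hp : ((l.length : ℤ), (l.length : ZMod 2)) = p)
    (hl : (l.map (u F n)).prod ∈ grading F n p) :
    decomposeHom F n (l.map (u F n)).prod =
      DirectSum.of (fun p => grading F n p) p ⟨(l.map (u F n)).prod, hl⟩ := by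
  induction l generalizing p with
  | nil =>
    subst hp
    simp only [List.map_nil, List.prod_nil, map_one]
    exact DirectSum.of_eq_of_gradedMonoid_eq (Sigma.subtype_ext (by
      change (0 : ℤ × ZMod 2) = (((0 : ℕ) : ℤ), ((0 : ℕ) : ZMod 2))
      simp [Prod.ext_iff]) rfl)
  | cons i l ih =>
    subst hp
    have hm : (l.map (u F n)).prod ∈ grading F n ((l.length : ℤ), (l.length : ZMod 2)) :=
      Submodule.subset_span ⟨l, rfl, rfl⟩
    have hu : decomposeHom F n (u F n i) = uDirect F n i := lift_u _ _ _ _ _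
    simp only [List.map_cons, List.prod_cons, map_mul]
    rw [ih _ rfl hm, hu, uDirect, DirectSum.of_mul_of]
    refine DirectSum.of_eq_of_gradedMonoid_eq (Sigma.subtype_ext ?_ rfl)
    change ((1, 1) + ((l.length : ℤ), (l.length : ZMod 2)) : ℤ × ZMod 2) =
      (((l.length + 1 : ℕ) : ℤ), ((l.length + 1 : ℕ) : ZMod 2))
    simp [add_comm]

instance : GradedAlgebra (grading F n) :=
  GradedAlgebra.ofAlgHom (grading F n) (decomposeHom F n)
    (hom_ext fun i => by
      have hu : decomposeHom F n (u F n i) = uDirect F n i := lift_u _ _ _ _ _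
      rw [AlgHom.comp_apply, hu, uDirect, DirectSum.coeAlgHom_of]
      rfl)
    (by
      rintro p ⟨x, hx⟩
      induction hx using Submodule.span_induction with
      | mem x h =>
        obtain ⟨l, hl, rfl⟩ := h
        exact decomposeHom_word F n l p hl _
      | zero =>
        exact (map_zero _).trans (map_zero (DirectSum.of (fun p => grading F n p) p)).symm
      | add x y hx hy ihx ihy =>
        have h := congrArg₂ (· + ·) ihx ihy
        simp only [← map_add] at h
        exact h
      | smul c x hx ih =>
        have h := congrArg (c • ·) ih
        simp only [← map_smul] at h
        refine h.trans ?_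
        exact (DirectSum.lof F _ (fun p => grading F n p) p).map_smul c ⟨x, hx⟩ |>.symm)

variable {F n}

/-- A homomorphism sending generators to elements of degree `(1, 1)` preserves degrees. -/
theorem map_mem_grading {k : ℕ} (f : Nilcoxeter F n →ₐ[F] Nilcoxeter F k)
    (h : ∀ i, f (u F n i) ∈ grading F k (1, 1)) {p : ℤ × ZMod 2} {x : Nilcoxeter F n}
    (hx : x ∈ grading F n p) : f x ∈ grading F k p := by
  induction hx using Submodule.span_induction with
  | mem x hx =>
    obtain ⟨l, rfl, rfl⟩ := hx
    induction l with
    | nil => exact Submodule.subset_span ⟨[], by simp, by simp⟩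
    | cons i l ih =>
      simp only [List.map_cons, List.prod_cons, map_mul]
      have h2 := SetLike.GradedMul.mul_mem (h i) ih
      convert h2 using 1
      simp [add_comm]
  | zero => rw [map_zero]; exact zero_mem _
  | add x y _ _ ihx ihy => rw [map_add]; exact add_mem ihx ihy
  | smul c x _ ih => rw [map_smul]; exact Submodule.smul_mem _ c ih

variable (F)

/-- The canonical homomorphism `N_m → N_n`, `u_i ↦ u_i`, for `m ≤ n`. -/
def inclAlgHom {m n : ℕ} (h : m ≤ n) : Nilcoxeter F m →ₐ[F] Nilcoxeter F n :=
  lift (fun i => u F n (Fin.castLE (Nat.sub_le_sub_right h 1) i))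
    (fun _ => u_sq F n _)
    (fun _ _ hij => u_comm F n _ _ hij)
    (fun _ _ hij => u_braid F n _ _ hij)

/-- The canonical homomorphism `N_m → N_n`, as a homomorphism of graded superrings. -/
def incl {m n : ℕ} (h : m ≤ n) : GradedRingHom (grading F m) (grading F n) where
  toRingHom := (inclAlgHom F h : Nilcoxeter F m →+* Nilcoxeter F n)
  map_mem hx := map_mem_grading (inclAlgHom F h)
    (fun i => by rw [inclAlgHom, lift_u]; exact u_mem F n _) hx

variable (n)

/-- The algebra endomorphism of `N_n` given by `u_i ↦ (-1) ^ (n.choose 2 + 1) u_{n-i}`. -/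
def nakayamaHom : Nilcoxeter F n →ₐ[F] Nilcoxeter F n :=
  lift (fun i => ((-1 : F) ^ (n.choose 2 + 1)) • u F n i.rev)
    (fun i => by rw [smul_mul_smul_comm, u_sq, smul_zero])
    (fun i j h => by
      rw [smul_mul_smul_comm, smul_mul_smul_comm, u_comm F n i.rev j.rev]
      simp only [Fin.val_rev]
      omega)
    (fun i j h => by
      simp only [smul_mul_smul_comm]
      rw [u_braid F n j.rev i.rev]
      simp only [Fin.val_rev]
      omega)

theorem nakayamaHom_u (i : Fin (n - 1)) :
    nakayamaHom F n (u F n i) = ((-1 : F) ^ (n.choose 2 + 1)) • u F n i.rev :=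
  lift_u _ _ _ _ _

theorem nakayamaHom_comp : (nakayamaHom F n).comp (nakayamaHom F n) = AlgHom.id F _ := by
  refine hom_ext fun i => ?_
  rw [AlgHom.comp_apply, nakayamaHom_u, map_smul, nakayamaHom_u, smul_smul, Fin.rev_rev, ← mul_pow]
  simp

/-- The automorphism `ψ_n` of `N_n`, given on the generators by
`ψ_n(u_i) = (-1) ^ (n.choose 2 + 1) u_{n-i}`. -/
def nakayama : Nilcoxeter F n ≃ₐ[F] Nilcoxeter F n :=
  AlgEquiv.ofAlgHom (nakayamaHom F n) (nakayamaHom F n)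
    (nakayamaHom_comp F n) (nakayamaHom_comp F n)

/-- `ψ_n` as an automorphism of graded superrings. -/
def nakayamaAut : GradedSuper.GradedAut (grading F n) where
  toRingEquiv := (nakayama F n).toRingEquiv
  map_mem' _ _ hx := map_mem_grading (nakayamaHom F n)
    (fun i => by rw [nakayamaHom_u]; exact Submodule.smul_mem _ _ (u_mem F n _)) hx

end Nilcoxeter

/-! Everything rests on a trace form. Let `N_n` act on functions on the symmetric group, `u_i`
sending the indicator of `w` to that of `w s_i` if this lengthens `w`, and to zero otherwise. Acting
on the indicator of `1` gives a surjection from `N_n`, and `n!` products span `N_n`, so it is an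
isomorphism (`rep_deltaOne_bijective`). The trace reads off the value at the longest element `w₀`.
It is homogeneous because word length counts inversions, and nondegenerate because every value of a
function can be moved to `w₀`. A right action commuting with the left one, together with `s_j w₀ =
w₀ s_{n-j}`, gives `tr (x u_j) = tr (u_{n-j} x)` (`trace_mul_u`). Iterating this yields the Nakayama
automorphism, and the sign is right because only top-degree products have nonzero trace.

The extension statement is general. For Frobenius superalgebras `B → A` with traces `tr_B`, `tr_A`
and Nakayama automorphisms `β`, `α`, nondegeneracy of `tr_B` defines `f : A → B` by `tr_B (b f(x)) =
± tr_A (β(b) x)`. Then `a ↦ (x ↦ ± f(x α(a)))` is the bimodule isomorphism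
(`IsFrobeniusTrace.exists_iso`): the Nakayama identities give compatibility with `B` on the right,
and duality over the field gives bijectivity. Freeness of `N_n` over `N_m` is a dimension count.

For the negative result, suppose the twist on `A` is the identity and let `f` be the image of `1`.
Then `tr_m ∘ f` is homogeneous and nondegenerate, hence a nonzero multiple of `tr_n`
(`exists_eq_smul_trace`). Moving `u_1` around in `tr_n (x u_1)` directly gives `u_{n-1}`; moving it
through `f` gives an element of `N_m`. Nondegeneracy forces these to be equal, but `u_{n-1}` is not
in `N_m`. -/

namespace GradedSuper

/-! ### Koszul signs and homogeneous components. -/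

section Twist

variable {Λ : Type*} [AddCommGroup Λ] [DecidableEq Λ]
variable {F A : Type*} [Field F] [Ring A] [Algebra F A]
variable (𝒜 : Λ × ZMod 2 → Submodule F A) [GradedAlgebra 𝒜]

/-- The linear map multiplying elements of parity `δ` by `(-1) ^ (γ δ)`. -/
def parityTwist (γ : ZMod 2) : A →ₗ[F] A :=
  (DirectSum.toModule F (Λ × ZMod 2) A
    fun q => ((-1 : ℤˣ) ^ (γ * q.2)) • (𝒜 q).subtype) ∘ₗ
    (DirectSum.decomposeLinearEquiv 𝒜).toLinearMap

theorem parityTwist_apply (γ : ZMod 2) {q : Λ × ZMod 2} {x : A} (hx : x ∈ 𝒜 q) :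
    parityTwist 𝒜 γ x = ((-1 : ℤˣ) ^ (γ * q.2)) • x := by
  simp only [parityTwist, LinearMap.comp_apply, LinearEquiv.coe_coe,
    DirectSum.decomposeLinearEquiv_apply, DirectSum.decompose_of_mem 𝒜 hx]
  exact DirectSum.toModule_lof (M := fun i => 𝒜 i) F q ⟨x, hx⟩

/-- The opposite multiplication of a superalgebra, `superMulOp y x = (-1) ^ (|y| |x|) x y` for
homogeneous `x` and `y`. -/
def superMulOp : A →ₗ[F] A →ₗ[F] A :=
  (DirectSum.toModule F (Λ × ZMod 2) (A →ₗ[F] A) fun p =>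
    LinearMap.lcomp F A (parityTwist 𝒜 p.2) ∘ₗ (LinearMap.mul F A).flip ∘ₗ (𝒜 p).subtype) ∘ₗ
    (DirectSum.decomposeLinearEquiv 𝒜).toLinearMap

theorem superMulOp_apply {p q : Λ × ZMod 2} {y x : A} (hy : y ∈ 𝒜 p) (hx : x ∈ 𝒜 q) :
    superMulOp 𝒜 y x = ((-1 : ℤˣ) ^ (p.2 * q.2)) • (x * y) := by
  have h : superMulOp 𝒜 y = LinearMap.lcomp F A (parityTwist 𝒜 p.2)
      ((LinearMap.mul F A).flip y) := by
    simp only [superMulOp, LinearMap.comp_apply, LinearEquiv.coe_coe,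
      DirectSum.decomposeLinearEquiv_apply, DirectSum.decompose_of_mem 𝒜 hy]
    exact DirectSum.toModule_lof (M := fun i => 𝒜 i) F p ⟨y, hy⟩
  rw [h]
  simp [parityTwist_apply 𝒜 _ hx]

variable {𝒜}

/-- Additive maps agreeing on homogeneous elements agree. -/
theorem addMonoidHom_ext {M : Type*} [AddCommMonoid M] {f g : A →+ M}
    (h : ∀ q, ∀ x ∈ 𝒜 q, f x = g x) : f = g := by
  ext x
  induction x using DirectSum.Decomposition.inductionOn 𝒜 with
  | zero => simp
  | homogeneous m => exact h _ _ m.2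
  | add x y hx hy => simp [hx, hy]

/-- A degree-preserving map commutes with the projections to components, so `a` minus its component
of degree `p` is killed by the injective map `α`. -/
theorem GradedAut.mem_of_apply_mem (α : GradedAut 𝒜) {p : Λ × ZMod 2} {a : A}
    (h : α a ∈ 𝒜 p) : a ∈ 𝒜 p := by
  classical
  have hα : ∀ t, α (DirectSum.decompose 𝒜 a t : A) = (DirectSum.decompose 𝒜 (α a) t : A) := by
    intro t
    have : (α.toRingEquiv : A →+* A).toAddMonoidHom.comp (GradedRing.proj 𝒜 t) =
        (GradedRing.proj 𝒜 t).comp (α.toRingEquiv : A →+* A).toAddMonoidHom := by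
      refine addMonoidHom_ext (𝒜 := 𝒜) fun q x hx => ?_
      by_cases hq : q = t
      · subst hq
        simp only [AddMonoidHom.comp_apply, GradedRing.proj_apply]
        rw [DirectSum.decompose_of_mem_same 𝒜 hx]
        exact (DirectSum.decompose_of_mem_same 𝒜 (α.map_mem' q x hx)).symm
      · simp only [AddMonoidHom.comp_apply, GradedRing.proj_apply]
        rw [DirectSum.decompose_of_mem_ne 𝒜 hx hq, map_zero]
        exact (DirectSum.decompose_of_mem_ne 𝒜 (α.map_mem' q x hx) hq).symm
    exact DFunLike.congr_fun this a
  have h0 : a - DirectSum.decompose 𝒜 a p = 0 := by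
    apply α.toRingEquiv.injective
    rw [map_zero, map_sub, hα, DirectSum.decompose_of_mem_same 𝒜 h, sub_self]
  rw [sub_eq_zero.1 h0]
  exact SetLike.coe_mem _

end Twist

/-! ### Duality for a Frobenius trace. -/

section FrobeniusTrace

variable {Λ : Type*} [AddCommGroup Λ] [DecidableEq Λ]
variable {F A : Type*} [Field F] [Ring A] [Algebra F A]
variable {𝒜 : Λ × ZMod 2 → Submodule F A} [GradedAlgebra 𝒜]
variable {deg : Λ × ZMod 2} {tr : A →ₗ[F] F}

namespace IsFrobeniusTrace

/-- The left ideal generated by `y` lies in the kernel of the trace. -/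
theorem eq_zero_of_mul (h : IsFrobeniusTrace 𝒜 deg tr) {y : A} (hy : ∀ x, tr (x * y) = 0) :
    y = 0 := by
  have := h.nondegenerate (Ideal.span {y}) fun a ha => by
    obtain ⟨b, rfl⟩ := Ideal.mem_span_singleton'.1 ha
    exact hy b
  exact Ideal.span_singleton_eq_bot.1 this

theorem eq_zero_of_homogeneous_mul (h : IsFrobeniusTrace 𝒜 deg tr) {y : A}
    (hy : ∀ q, ∀ x ∈ 𝒜 q, tr (x * y) = 0) : y = 0 := by
  refine h.eq_zero_of_mul fun x => ?_
  have := addMonoidHom_ext (𝒜 := 𝒜)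
    (f := (tr ∘ₗ LinearMap.mulRight F y).toAddMonoidHom) (g := 0) hy
  exact DFunLike.congr_fun this x

theorem ext_of_homogeneous_mul (h : IsFrobeniusTrace 𝒜 deg tr) {y z : A}
    (hy : ∀ q, ∀ x ∈ 𝒜 q, tr (x * y) = tr (x * z)) : y = z :=
  sub_eq_zero.1 <| h.eq_zero_of_homogeneous_mul fun q x hx => by
    rw [mul_sub, map_sub, hy q x hx, sub_self]

/-- The isomorphism `y ↦ tr (· y)` of a Frobenius algebra with its dual space. -/
noncomputable def dualEquiv (h : IsFrobeniusTrace 𝒜 deg tr) : A ≃ₗ[F] Module.Dual F A :=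
  haveI := h.finite
  LinearEquiv.ofInjectiveOfFinrankEq
    ((LinearMap.mul F A).flip.compr₂ tr)
    ((injective_iff_map_eq_zero _).2 fun _ hy => h.eq_zero_of_mul fun x =>
      LinearMap.congr_fun hy x)
    Subspace.dual_finrank_eq.symm

theorem dualEquiv_apply (h : IsFrobeniusTrace 𝒜 deg tr) (x y : A) :
    h.dualEquiv y x = tr (x * y) := rfl

theorem trace_mul_dualEquiv_symm (h : IsFrobeniusTrace 𝒜 deg tr) (φ : Module.Dual F A) (x : A) :
    tr (x * h.dualEquiv.symm φ) = φ x := by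
  rw [← h.dualEquiv_apply, LinearEquiv.apply_symm_apply]

theorem trace_mul_eq_zero (h : IsFrobeniusTrace 𝒜 deg tr) {p q : Λ × ZMod 2} {x y : A}
    (hx : x ∈ 𝒜 p) (hy : y ∈ 𝒜 q) (hpq : deg + (p + q) ≠ 0) : tr (x * y) = 0 :=
  h.homogeneous _ _ (SetLike.mul_mem_graded hx hy) hpq

/-- An element `y` for which `tr (· y)` is homogeneous is homogeneous. -/
theorem mem_of_trace_mul (h : IsFrobeniusTrace 𝒜 deg tr) {t : Λ × ZMod 2} {y : A}
    (hy : ∀ q, ∀ x ∈ 𝒜 q, deg + (q + t) ≠ 0 → tr (x * y) = 0) : y ∈ 𝒜 t := by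
  classical
  suffices y = DirectSum.decompose 𝒜 y t by rw [this]; exact SetLike.coe_mem _
  refine h.ext_of_homogeneous_mul fun q x hx => ?_
  -- In the complementary degree, pairing with `x` sees only the component of `y` in degree `t`; in
  -- all other degrees both pairings vanish.
  by_cases hq : deg + (q + t) = 0
  · have : (tr ∘ₗ LinearMap.mulLeft F x).toAddMonoidHom =
        (tr ∘ₗ LinearMap.mulLeft F x).toAddMonoidHom.comp (GradedRing.proj 𝒜 t) := by
      refine addMonoidHom_ext (𝒜 := 𝒜) fun r z hz => ?_
      simp only [AddMonoidHom.comp_apply, GradedRing.proj_apply, LinearMap.toAddMonoidHom_coe,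
        LinearMap.comp_apply, LinearMap.mulLeft_apply]
      by_cases hr : r = t
      · subst hr
        rw [DirectSum.decompose_of_mem_same 𝒜 hz]
      · rw [DirectSum.decompose_of_mem_ne 𝒜 hz hr, mul_zero, map_zero]
        refine h.trace_mul_eq_zero hx hz fun h0 => hr ?_
        exact add_left_cancel (add_left_cancel (h0.trans hq.symm))
    exact DFunLike.congr_fun this y
  · rw [hy q x hx hq, h.trace_mul_eq_zero hx (SetLike.coe_mem _) hq]

/-- Only the component of `y` in degree `-deg - q` contributes to the trace, so the sign depends on
`x` alone. This allows `y` to be inhomogeneous. -/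
theorem trace_superMulOp (h : IsFrobeniusTrace 𝒜 deg tr) {q : Λ × ZMod 2} {x : A} (hx : x ∈ 𝒜 q)
    (y : A) : tr (superMulOp 𝒜 y x) = ((-1 : ℤˣ) ^ ((-deg - q).2 * q.2)) • tr (x * y) := by
  induction y using DirectSum.Decomposition.inductionOn 𝒜 with
  | zero => simp
  | @homogeneous r m =>
    rw [superMulOp_apply 𝒜 m.2 hx, map_zsmul_unit]
    by_cases hr : deg + (q + r) = 0
    · rw [show -deg - q = r by
        rw [sub_eq_iff_eq_add, neg_eq_iff_add_eq_zero, ← hr]; abel]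
    · rw [h.trace_mul_eq_zero hx m.2 hr, smul_zero, smul_zero]
  | add y z hy hz => rw [map_add, LinearMap.add_apply, map_add, hy, hz, mul_add, map_add, smul_add]

end IsFrobeniusTrace

end FrobeniusTrace

/-! ### Twisted Frobenius extensions from Nakayama automorphisms. -/

section Extension

variable {Λ : Type*} [AddCommGroup Λ] [DecidableEq Λ]
variable {F A B : Type*} [Field F] [Ring A] [Algebra F A] [Ring B] [Algebra F B]
variable {𝒜 : Λ × ZMod 2 → Submodule F A}
variable {ℬ : Λ × ZMod 2 → Submodule F B} [GradedAlgebra ℬ]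
variable {dA dB : Λ × ZMod 2} {trA : A →ₗ[F] F} {trB : B →ₗ[F] F}

/-- The relative trace of an extension of Frobenius graded superalgebras, twisted by an
automorphism of the smaller algebra. -/
theorem IsFrobeniusTrace.exists_relative_trace (trA : A →ₗ[F] F)
    (hB : IsFrobeniusTrace ℬ dB trB) (ι : GradedRingHom ℬ 𝒜) (hι : ∀ (c : F) b, ι (c • b) = c • ι b)
    (β : GradedAut ℬ) (hβ : ∀ (c : F) b, β (c • b) = c • β b) (π : ZMod 2) :
    ∃ f : A →ₗ[F] B, ∀ r, ∀ b ∈ ℬ r, ∀ x,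
      trB (b * f x) = ((-1 : ℤˣ) ^ (π * r.2)) • trA (ι (β b) * x) := by
  -- The value at `x` is the element of `B` that represents, via `trB`, the signed functional `b ↦ ±
  -- trA (ι (β b) * x)`.
  let g : A →ₗ[F] Module.Dual F B := LinearMap.mk₂ F
    (fun x b => trA (ι (β (parityTwist ℬ π b)) * x))
    (fun _ _ _ => by simp [mul_add]) (fun _ _ _ => by simp)
    (fun x b c => by
      rw [map_add]
      exact (congrArg (fun t => trA (ι t * x)) (map_add β.toRingEquiv _ _)).trans (by
        rw [map_add, add_mul, map_add]))
    (fun c x b => by rw [map_smul, hβ, hι, smul_mul_assoc, map_smul])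
  refine ⟨hB.dualEquiv.symm.toLinearMap ∘ₗ g, fun r b hb x => ?_⟩
  rw [LinearMap.comp_apply, LinearEquiv.coe_coe, hB.trace_mul_dualEquiv_symm]
  change trA (ι (β (parityTwist ℬ π b)) * x) = _
  rw [parityTwist_apply ℬ π hb]
  have h1 : β (((-1 : ℤˣ) ^ (π * r.2)) • b) = ((-1 : ℤˣ) ^ (π * r.2)) • β b :=
    map_zsmul_unit β.toRingEquiv _ _
  rw [h1, map_zsmul_unit, smul_mul_assoc, map_zsmul_unit]

variable [GradedAlgebra 𝒜]

/-- A homogeneous extension of Frobenius graded superalgebras is a twisted Frobenius extension, up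
to projectivity: the bimodule isomorphism exists. -/
theorem IsFrobeniusTrace.exists_iso (hA : IsFrobeniusTrace 𝒜 dA trA)
    (hB : IsFrobeniusTrace ℬ dB trB) (ι : GradedRingHom ℬ 𝒜) (hι : ∀ (c : F) b, ι (c • b) = c • ι b)
    (α : GradedAut 𝒜) (β : GradedAut ℬ) (hβ : ∀ (c : F) b, β (c • b) = c • β b)
    (hαN : ∀ (p q : Λ × ZMod 2) (a₁ a₂ : A), a₁ ∈ 𝒜 p → a₂ ∈ 𝒜 q →
      trA (a₁ * a₂) = ((-1 : ℤˣ) ^ (p.2 * q.2)) • trA (a₂ * α a₁))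
    (hβN : ∀ (p q : Λ × ZMod 2) (a₁ a₂ : B), a₁ ∈ ℬ p → a₂ ∈ ℬ q →
      trB (a₁ * a₂) = ((-1 : ℤˣ) ^ (p.2 * q.2)) • trB (a₂ * β a₁))
    (deg : Λ × ZMod 2) (hdeg : deg = dA - dB) :
    ∃ Φ : A ≃+ HOM 𝒜 ℬ ι β (-deg.1) deg.2,
    (∀ (p : Λ × ZMod 2) (a : A), a ∈ 𝒜 p →
      (Φ a : A →+ B) ∈ homComponent 𝒜 ℬ ι β (-deg.1) deg.2 p) ∧
    (∀ (p q r : Λ × ZMod 2) (a y x : A), a ∈ 𝒜 p → y ∈ 𝒜 q → x ∈ 𝒜 r →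
      (Φ (a * y) : A →+ B) x =
        ((-1 : ℤˣ) ^ (p.2 * q.2)) • ((-1 : ℤˣ) ^ (p.2 * r.2)) • (Φ y : A →+ B) (x * α a)) ∧
    (∀ (p q r : Λ × ZMod 2) (b : B) (y x : A), b ∈ ℬ p → y ∈ 𝒜 q → x ∈ 𝒜 r →
      (Φ (y * ι b) : A →+ B) x =
        ((-1 : ℤˣ) ^ (p.2 * q.2)) • ((-1 : ℤˣ) ^ (p.2 * (q.2 + r.2))) •
          ((Φ y : A →+ B) x * b)) := by
  classical
  obtain ⟨f, hf⟩ := hB.exists_relative_trace trA ι hι β hβ deg.2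
  have hαm : ∀ a b, α (a * b) = α a * α b := map_mul α.toRingEquiv
  have hβm : ∀ a b, β (a * b) = β a * β b := map_mul β.toRingEquiv
  have hιm : ∀ a b, ι (a * b) = ι a * ι b := map_mul ι
  have hβmem : ∀ p, ∀ b ∈ ℬ p, β b ∈ ℬ p := β.map_mem'
  have hαmem : ∀ p, ∀ a ∈ 𝒜 p, α a ∈ 𝒜 p := α.map_mem'
  have hιmem : ∀ p, ∀ b ∈ ℬ p, ι b ∈ 𝒜 p := fun p b hb => ι.map_mem hb
  have hfdeg : ∀ q, ∀ x ∈ 𝒜 q, f x ∈ ℬ (q + deg) := by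
    intro q x hx
    refine hB.mem_of_trace_mul fun r b hb hne => ?_
    rw [hf r b hb, hA.trace_mul_eq_zero (hιmem _ _ (hβmem _ _ hb)) hx, smul_zero]
    rw [hdeg] at hne
    intro h0
    exact hne (by rw [← h0]; abel)
  have hshift : ∀ (p : Λ × ZMod 2) (y : B), y ∈ shift ℬ (-deg.1) deg.2 p ↔ y ∈ ℬ (p + deg) := by
    intro p y
    rw [shift, sub_neg_eq_add]
    rfl
  have hfleft : ∀ r, ∀ b ∈ ℬ r, ∀ x, f (ι (β b) * x) = ((-1 : ℤˣ) ^ (deg.2 * r.2)) • (b * f x) := by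
    intro r b hb x
    refine hB.ext_of_homogeneous_mul fun s c hc => ?_
    rw [hf s c hc, mul_smul_comm, map_zsmul_unit, ← mul_assoc, ← mul_assoc,
      hf _ _ (SetLike.mul_mem_graded hc hb), hβm, hιm, smul_smul, ← uzpow_add]
    congr 2
    simp only [Prod.snd_add]
    -- The remaining sign identity concerns finitely many parities and is checked on all their
    -- values, here and below.
    generalize deg.2 = d, r.2 = r', s.2 = s'
    revert d r' s'; decide
  -- With `c = β c'`, the Nakayama identity of `A` carries `α (ι c)` to the front as `ι (β c')`. The
  -- definition of `f` turns this into `c'` in front of `b * f x`, and the Nakayama identity of `B`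
  -- carries it to the back as `c`.
  have hfright : ∀ r, ∀ c ∈ ℬ r, ∀ s, ∀ x ∈ 𝒜 s, f (x * α (ι c)) = f x * c := by
    intro r c hc s x hx
    refine hB.ext_of_homogeneous_mul fun t b hb => ?_
    set c' := β.toRingEquiv.symm c
    have hcc : β c' = c := β.toRingEquiv.apply_symm_apply c
    have hc'm : c' ∈ ℬ r := β.mem_of_apply_mem (hcc.symm ▸ hc)
    have h1 := hαN r (t + s) (ι c) (ι (β b) * x) (hιmem _ _ hc)
      (SetLike.mul_mem_graded (hιmem _ _ (hβmem _ _ hb)) hx)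
    have h2 := hβN r (t + (s + deg)) c' (b * f x) hc'm
      (SetLike.mul_mem_graded hb (hfdeg s x hx))
    have h3 := hf _ _ (SetLike.mul_mem_graded hc'm hb) x
    rw [hcc] at h2
    rw [hβm, hcc, hιm, mul_assoc, mul_assoc, h1, h2, mul_assoc, mul_assoc] at h3
    rw [hf t b hb]
    have h4 := congrArg (((-1 : ℤˣ) ^ (r.2 * (t + (s + deg)).2)) • ·) h3
    simp only [smul_smul, Int.units_mul_self, one_smul, ← uzpow_add] at h4
    rw [h4]
    congr 2
    simp only [Prod.snd_add]
    generalize deg.2 = d, r.2 = r', s.2 = s', t.2 = t'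
    revert d r' s' t'; decide
  -- the isomorphism, with values in all additive maps
  let Ψ : A →+ A →+ B :=
    { toFun := fun a => (f ∘ₗ superMulOp 𝒜 (α a)).toAddMonoidHom
      map_zero' := by
        have : α 0 = 0 := map_zero α.toRingEquiv
        ext x; simp [this]
      map_add' := fun a b => by
        have : α (a + b) = α a + α b := map_add α.toRingEquiv a b
        ext x; simp [this] }
  have hΨ : ∀ p, ∀ a ∈ 𝒜 p, ∀ q, ∀ x ∈ 𝒜 q,
      Ψ a x = ((-1 : ℤˣ) ^ (p.2 * q.2)) • f (x * α a) := by
    intro p a ha q x hx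
    change f (superMulOp 𝒜 (α a) x) = _
    rw [superMulOp_apply 𝒜 (hαmem _ _ ha) hx, map_zsmul_unit]
  have hΨmem : ∀ p, ∀ a ∈ 𝒜 p, Ψ a ∈ homComponent 𝒜 ℬ ι β (-deg.1) deg.2 p := by
    intro p a ha
    refine ⟨fun q x hx => ?_, fun q b hb x => ?_⟩
    · rw [hshift, hΨ p a ha q x hx, add_comm p q]
      exact (ℬ _).toAddSubgroup.zsmul_mem (hfdeg _ _ (SetLike.mul_mem_graded hx (hαmem _ _ ha))) _
    · refine DFunLike.congr_fun (addMonoidHom_ext (𝒜 := 𝒜)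
        (f := (Ψ a).comp (AddMonoidHom.mulLeft (ι (β b))))
        (g := ((-1 : ℤˣ) ^ (p.2 * q.2)) • (((-1 : ℤˣ) ^ (deg.2 * q.2)) •
          (AddMonoidHom.mulLeft b).comp (Ψ a))) fun r x hx => ?_) x
      change Ψ a (ι (β b) * x) =
        ((-1 : ℤˣ) ^ (p.2 * q.2)) • ((-1 : ℤˣ) ^ (deg.2 * q.2)) • (b * Ψ a x)
      rw [hΨ p a ha r x hx, hΨ p a ha _ _ (SetLike.mul_mem_graded (hιmem _ _ (hβmem _ _ hb)) hx),
        mul_assoc, hfleft q b hb, mul_smul_comm]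
      simp only [smul_smul, ← uzpow_add]
      congr 2
      simp only [Prod.snd_add]
      generalize deg.2 = d, r.2 = r', p.2 = p', q.2 = q'
      revert d r' p' q'; decide
  have hΨHOM : ∀ a, Ψ a ∈ HOM 𝒜 ℬ ι β (-deg.1) deg.2 := by
    intro a
    induction a using DirectSum.Decomposition.inductionOn 𝒜 with
    | zero => rw [map_zero]; exact zero_mem _
    | @homogeneous p m =>
      exact (le_iSup (fun p => homComponent 𝒜 ℬ ι β (-deg.1) deg.2 p) p) (hΨmem p m m.2)
    | add x y hx hy => rw [map_add]; exact add_mem hx hy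
  have htrf : ∀ x, trB (f x) = trA x := by
    intro x
    have h1 := hf 0 1 SetLike.GradedOne.one_mem x
    have h2 : β 1 = 1 := map_one β.toRingEquiv
    have h3 : ι 1 = 1 := map_one ι
    rwa [h2, h3, one_mul, one_mul, Prod.snd_zero, mul_zero, uzpow_zero, one_smul] at h1
  -- Since `trB ∘ f = trA`, the vanishing of `Ψ a` makes `trA (x * α a)` vanish for all homogeneous
  -- `x`.
  have hinj : Function.Injective Ψ := by
    refine (injective_iff_map_eq_zero _).2 fun a ha => ?_
    have h0 : α a = 0 := hA.eq_zero_of_homogeneous_mul fun q x hx => by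
      have h1 : trB (Ψ a x) = 0 := by rw [ha]; exact map_zero trB
      change trB (f (superMulOp 𝒜 (α a) x)) = 0 at h1
      rw [htrf, hA.trace_superMulOp hx] at h1
      exact (smul_eq_zero_iff_eq _).1 h1
    exact α.toRingEquiv.injective (h0.trans (map_zero α.toRingEquiv).symm)
  have hsurj : ∀ p, ∀ g ∈ homComponent 𝒜 ℬ ι β (-deg.1) deg.2 p, ∃ a, Ψ a = g := by
    rintro p g ⟨hgdeg, hgl⟩
    -- The map `g` is only additive a priori; linearity over the field comes from its
    -- `B`-semilinearity at the degree-zero elements `c • 1`.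
    have hg : ∀ (c : F) x, g (c • x) = c • g x := by
      intro c x
      have h1 := hgl 0 (c • 1) ((ℬ 0).smul_mem c SetLike.GradedOne.one_mem) x
      have h2 : β 1 = 1 := map_one β.toRingEquiv
      have h3 : ι 1 = 1 := map_one ι
      simpa [shiftAct, hβ, hι, h2, h3] using h1
    let g' : A →ₗ[F] B := { g with map_smul' := hg }
    -- The preimage of `g` is `α⁻¹ y`, where `y` represents `x ↦ ± trB (g x)` through `trA`. The
    -- twist cancels the sign in `Ψ`, and testing against `trB (b * ·)` recovers `g` itself.
    let φ : Module.Dual F A := trB ∘ₗ g' ∘ₗ parityTwist 𝒜 p.2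
    have hφ : ∀ q, ∀ x ∈ 𝒜 q, φ x = ((-1 : ℤˣ) ^ (p.2 * q.2)) • trB (g x) := by
      intro q x hx
      change trB (g' (parityTwist 𝒜 p.2 x)) = _
      rw [parityTwist_apply 𝒜 _ hx, map_zsmul_unit, map_zsmul_unit]
      rfl
    set y := hA.dualEquiv.symm φ
    have hytr : ∀ x, trA (x * y) = φ x := hA.trace_mul_dualEquiv_symm φ
    have hyp : y ∈ 𝒜 p := by
      refine hA.mem_of_trace_mul fun q x hx hne => ?_
      rw [hytr, hφ q x hx, hB.homogeneous _ _ ((hshift _ _).1 (hgdeg q x hx)), smul_zero]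
      rw [hdeg]
      intro h0
      exact hne (by rw [← h0]; abel)
    set a := α.toRingEquiv.symm y
    have hay : α a = y := α.toRingEquiv.apply_symm_apply y
    have hap : a ∈ 𝒜 p := α.mem_of_apply_mem (hay.symm ▸ hyp)
    refine ⟨a, addMonoidHom_ext (𝒜 := 𝒜) fun q x hx => ?_⟩
    rw [hΨ p a hap q x hx, hay]
    refine hB.ext_of_homogeneous_mul fun r b hb => ?_
    have h1 := hgl r b hb x
    rw [mul_smul_comm, map_zsmul_unit, hf r b hb, ← mul_assoc, hytr,
      hφ _ _ (SetLike.mul_mem_graded (hιmem _ _ (hβmem _ _ hb)) hx), h1, shiftAct, map_zsmul_unit,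
      map_zsmul_unit]
    simp only [smul_smul, ← uzpow_add]
    nth_rw 2 [← one_smul ℤˣ (trB (b * g x))]
    -- The trivial sign is written as a power of `-1`, so that only exponents need to be compared.
    rw [← uzpow_zero (R := ZMod 2) (-1 : ℤˣ)]
    congr 2
    simp only [Prod.snd_add]
    generalize deg.2 = d, r.2 = r', p.2 = p', q.2 = q'
    revert d r' p' q'; decide
  let Ψ' : A →+ HOM 𝒜 ℬ ι β (-deg.1) deg.2 := Ψ.codRestrict _ hΨHOM
  have hrange : HOM 𝒜 ℬ ι β (-deg.1) deg.2 ≤ Ψ.range :=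
    iSup_le fun p g hg => hsurj p g hg
  refine ⟨AddEquiv.ofBijective Ψ' ⟨fun a b hab => hinj (congrArg Subtype.val hab), fun g => ?_⟩,
    hΨmem, fun p q r a y x ha hy hx => ?_, fun p q r b y x hb hy hx => ?_⟩
  · obtain ⟨a, ha⟩ := hrange g.2
    exact ⟨a, Subtype.ext ha⟩
  · change Ψ (a * y) x = _ • _ • Ψ y (x * α a)
    rw [hΨ _ _ (SetLike.mul_mem_graded ha hy) r x hx,
      hΨ q y hy _ _ (SetLike.mul_mem_graded hx (hαmem _ _ ha)), hαm, mul_assoc]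
    simp only [smul_smul, ← uzpow_add]
    congr 2
    simp only [Prod.snd_add]
    generalize r.2 = r', p.2 = p', q.2 = q'
    revert r' p' q'; decide
  · change Ψ (y * ι b) x = _ • _ • (Ψ y x * b)
    rw [hΨ _ _ (SetLike.mul_mem_graded hy (hιmem _ _ hb)) r x hx, hΨ q y hy r x hx, hαm,
      ← mul_assoc, hfright p b hb _ _ (SetLike.mul_mem_graded hx (hαmem _ _ hy)), smul_mul_assoc]
    simp only [smul_smul, ← uzpow_add]
    congr 2
    simp only [Prod.snd_add]
    generalize r.2 = r', p.2 = p', q.2 = q'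
    revert r' p' q'; decide

end Extension

end GradedSuper

namespace Nilcoxeter

/-! ### Spanning `N_n` over `N_m` by descending products. -/

section Representation

variable (F : Type*) [Field F]

/-- The generator `u_{i+1}` of `N_n` for `i + 1 < n`, and zero for all other `i`. -/
def U (n i : ℕ) : Nilcoxeter F n := if h : i < n - 1 then u F n ⟨i, h⟩ else 0

variable {F}

theorem U_of_lt {n i : ℕ} (h : i < n - 1) : U F n i = u F n ⟨i, h⟩ := dif_pos h

theorem U_of_le {n i : ℕ} (h : n - 1 ≤ i) : U F n i = 0 := dif_neg h.not_gt

theorem U_sq (n i : ℕ) : U F n i * U F n i = 0 := by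
  by_cases h : i < n - 1
  · rw [U_of_lt h, u_sq]
  · rw [U_of_le (not_lt.1 h), mul_zero]

theorem U_comm {n i j : ℕ} (hij : i + 1 < j) : U F n i * U F n j = U F n j * U F n i := by
  by_cases h : j < n - 1
  · rw [U_of_lt h, U_of_lt (show i < n - 1 by omega), u_comm]
    exact Or.inl hij
  · rw [U_of_le (not_lt.1 h), mul_zero, zero_mul]

theorem U_braid (n i : ℕ) :
    U F n i * U F n (i + 1) * U F n i = U F n (i + 1) * U F n i * U F n (i + 1) := by
  by_cases h : i + 1 < n - 1
  · rw [U_of_lt h, U_of_lt (show i < n - 1 by omega), u_braid]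
    rfl
  · rw [U_of_le (not_lt.1 h)]
    simp

theorem inclAlgHom_U {m n i : ℕ} (h : m ≤ n) (hi : i < m - 1) :
    inclAlgHom F h (U F m i) = U F n i := by
  rw [U_of_lt hi, U_of_lt (show i < n - 1 by omega), inclAlgHom, lift_u]
  rfl

theorem inclAlgHom_self (n : ℕ) : inclAlgHom F (le_refl n) = AlgHom.id F _ :=
  hom_ext fun i => by rw [inclAlgHom, lift_u]; rfl

theorem inclAlgHom_comp {k m n : ℕ} (h : k ≤ m) (h' : m ≤ n) :
    (inclAlgHom F h').comp (inclAlgHom F h) = inclAlgHom F (h.trans h') :=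
  hom_ext fun i => by
    simp only [inclAlgHom, lift_u, AlgHom.comp_apply]
    rfl

/-- A subspace containing `1` and stable under right multiplication by the generators is
everything. -/
theorem eq_top_of_one_mem_of_mul_mem {n : ℕ} (S : Submodule F (Nilcoxeter F n)) (h1 : 1 ∈ S)
    (hS : ∀ x ∈ S, ∀ i, x * u F n i ∈ S) : S = ⊤ := by
  have hw : ∀ (l : List (Fin (n - 1))), (l.map (u F n)).prod ∈ S := by
    intro l
    induction l using List.reverseRecOn with
    | nil => simpa using h1
    | append_singleton l i ih => simpa using hS _ ih i
  refine eq_top_iff.2 fun x _ => ?_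
  induction x using DirectSum.Decomposition.inductionOn (grading F n) with
  | zero => exact zero_mem _
  | @homogeneous p m =>
    have : grading F n p ≤ S := Submodule.span_le.2 fun y hy => by
      obtain ⟨l, -, rfl⟩ := hy
      exact hw l
    exact this m.2
  | add x y hx hy => exact add_mem (hx trivial) (hy trivial)

variable (F) in
/-- The product `u_n u_{n-1} ⋯ u_{n-k+1}` of `k` generators of `N_{n+1}`. -/
def descProd (n : ℕ) : ℕ → Nilcoxeter F (n + 1)
  | 0 => 1
  | k + 1 => descProd n k * U F (n + 1) (n - 1 - k)

theorem descProd_mul_U_of_lt {n k j : ℕ} (h : j + k + 1 < n) :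
    descProd F n k * U F (n + 1) j = U F (n + 1) j * descProd F n k := by
  induction k with
  | zero => simp [descProd]
  | succ k ih =>
    rw [descProd, mul_assoc, ← U_comm (by omega), ← mul_assoc, ih (by omega), mul_assoc]

/-- The generator moves left by commutations until it follows the letters of indices `j + 1` and
`j`. There a braid move lowers its index by one, after which it commutes with the rest. -/
theorem descProd_mul_U_of_gt {n k j : ℕ} (hk : k ≤ n) (hj : n < j + 1 + k) (hjn : j + 1 < n) :
    descProd F n k * U F (n + 1) (j + 1) = U F (n + 1) j * descProd F n k := by
  induction k with
  | zero => omega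
  | succ k ih =>
    rcases Nat.lt_or_ge n (j + 1 + k) with h | h
    · rw [descProd, mul_assoc, U_comm (by omega), ← mul_assoc, ih (by omega) h, mul_assoc]
    · obtain ⟨k, rfl⟩ : ∃ l, k = l + 1 := ⟨k - 1, by omega⟩
      have e1 : n - 1 - (k + 1) = j := by omega
      have e2 : n - 1 - k = j + 1 := by omega
      rw [descProd, descProd, e1, e2]
      calc _ = descProd F n k * (U F (n + 1) (j + 1) * U F (n + 1) j * U F (n + 1) (j + 1)) := by
            simp only [mul_assoc]
        _ = descProd F n k * U F (n + 1) j * U F (n + 1) (j + 1) * U F (n + 1) j := by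
            rw [← U_braid]; simp only [mul_assoc]
        _ = _ := by
            rw [descProd_mul_U_of_lt (by omega)]; simp only [mul_assoc]

/-- Four cases: a small index commutes past the product, the next index lengthens it, the index of
the last letter gives a square and hence zero, and a larger index passes through lowered by one. In
each case what appears on the left lies in `N_n`. -/
theorem exists_descProd_mul_U (n : ℕ) (k : Fin (n + 1)) (i : Fin n) :
    ∃ (b : Nilcoxeter F n) (l : Fin (n + 1)), descProd F n k * u F (n + 1) i =
      inclAlgHom F n.le_succ b * descProd F n l := by
  obtain ⟨k, hk⟩ := k
  obtain ⟨i, hi⟩ := i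
  have hu : u F (n + 1) ⟨i, hi⟩ = U F (n + 1) i := (U_of_lt (n := n + 1) hi).symm
  rw [hu]
  rcases lt_trichotomy (i + k + 1) n with h | h | h
  · exact ⟨U F n i, ⟨k, hk⟩, by
      rw [descProd_mul_U_of_lt h, inclAlgHom_U _ (by omega)]⟩
  · refine ⟨1, ⟨k + 1, by omega⟩, ?_⟩
    rw [map_one, one_mul, descProd, show n - 1 - k = i by omega]
  · rcases Nat.lt_or_ge n (i + k) with h' | h'
    · obtain ⟨i, rfl⟩ : ∃ l, i = l + 1 := ⟨i - 1, by omega⟩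
      refine ⟨U F n i, ⟨k, hk⟩, ?_⟩
      rw [descProd_mul_U_of_gt (by omega) (by omega) (by omega), inclAlgHom_U _ (by omega)]
    · obtain ⟨k, rfl⟩ : ∃ l, k = l + 1 := ⟨k - 1, by omega⟩
      refine ⟨0, 0, ?_⟩
      rw [map_zero, zero_mul, descProd, show n - 1 - k = i by omega, mul_assoc, U_sq, mul_zero]

/-- By the preceding lemma, the `N_n`-span of the descending products contains `1` and is stable
under right multiplication by generators. -/
theorem exists_eq_sum_descProd (n : ℕ) (x : Nilcoxeter F (n + 1)) :
    ∃ b : Fin (n + 1) → Nilcoxeter F n,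
      x = ∑ k, inclAlgHom F n.le_succ (b k) * descProd F n k := by
  let L : (Fin (n + 1) → Nilcoxeter F n) →ₗ[F] Nilcoxeter F (n + 1) :=
    ∑ k : Fin (n + 1), LinearMap.mulRight F (descProd F n k) ∘ₗ
      (inclAlgHom F n.le_succ).toLinearMap ∘ₗ LinearMap.proj k
  have hL : ∀ b, L b = ∑ k, inclAlgHom F n.le_succ (b k) * descProd F n k := fun b => by
    simp [L]
  have hsingle : ∀ b k, inclAlgHom F n.le_succ b * descProd F n (k : Fin (n + 1)) ∈
      LinearMap.range L := fun b k => ⟨Pi.single k b, by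
    rw [hL, Finset.sum_eq_single k (fun l _ hl => by rw [Pi.single_eq_of_ne hl]; simp) (by simp),
      Pi.single_eq_same]⟩
  have hr : LinearMap.range L = ⊤ := by
    refine eq_top_of_one_mem_of_mul_mem _ (by simpa [descProd] using hsingle 1 0) ?_
    rintro _ ⟨b, rfl⟩ i
    rw [hL, Finset.sum_mul]
    refine sum_mem fun k _ => ?_
    obtain ⟨b', l, h⟩ := exists_descProd_mul_U (F := F) n k i
    rw [mul_assoc]
    erw [h]
    rw [← mul_assoc, ← map_mul]
    exact hsingle _ _
  obtain ⟨b, hb⟩ := LinearMap.range_eq_top.1 hr x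
  exact ⟨b, hb.symm.trans (hL b)⟩

/-- For `m ≤ n`, the left `N_m`-module `N_n` is generated by `n! / m!` elements. -/
theorem exists_generators {m n : ℕ} (h : m ≤ n) :
    ∃ (κ : Type) (_ : Fintype κ) (c : κ → Nilcoxeter F n),
      Fintype.card κ * m.factorial = n.factorial ∧
      ∀ x, ∃ b : κ → Nilcoxeter F m, x = ∑ k, inclAlgHom F h (b k) * c k := by
  induction n, h using Nat.le_induction with
  | base => exact ⟨Unit, inferInstance, fun _ => 1, by simp, fun x => ⟨fun _ => x, by
      simp [inclAlgHom_self]⟩⟩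
  | succ n h ih =>
    obtain ⟨κ, _, c, hc, hx⟩ := ih
    refine ⟨Fin (n + 1) × κ, inferInstance,
      fun k => inclAlgHom F n.le_succ (c k.2) * descProd F n k.1, ?_, fun x => ?_⟩
    · rw [Fintype.card_prod, Fintype.card_fin, mul_assoc, hc, Nat.factorial_succ]
    · obtain ⟨b, hb⟩ := exists_eq_sum_descProd n x
      choose d hd using fun k => hx (b k)
      refine ⟨fun k => d k.1 k.2, ?_⟩
      rw [hb, Fintype.sum_prod_type]
      refine Finset.sum_congr rfl fun k _ => ?_
      rw [hd k, map_sum, Finset.sum_mul]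
      refine Finset.sum_congr rfl fun l _ => ?_
      rw [map_mul, mul_assoc, ← AlgHom.comp_apply, inclAlgHom_comp]

/-- The linear map `b ↦ ∑ k, b_k c_k`. -/
def combination {m n : ℕ} (h : m ≤ n) {κ : Type} [Fintype κ] (c : κ → Nilcoxeter F n) :
    (κ → Nilcoxeter F m) →ₗ[F] Nilcoxeter F n :=
  ∑ k, LinearMap.mulRight F (c k) ∘ₗ (inclAlgHom F h).toLinearMap ∘ₗ LinearMap.proj k

theorem combination_apply {m n : ℕ} (h : m ≤ n) {κ : Type} [Fintype κ] (c : κ → Nilcoxeter F n)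
    (b : κ → Nilcoxeter F m) : combination h c b = ∑ k, inclAlgHom F h (b k) * c k := by
  simp [combination]

theorem grading_zero_component {n : ℕ} {x : Nilcoxeter F n} {p : ℤ × ZMod 2} (hp : p.1 = 0)
    (hx : x ∈ grading F n p) : ∃ c : F, x = algebraMap F _ c := by
  have : grading F n p ≤ (Algebra.linearMap F (Nilcoxeter F n)).range :=
    Submodule.span_le.2 fun y hy => by
      obtain ⟨l, hl, rfl⟩ := hy
      have : l.length = 0 := by
        have := congrArg Prod.fst hl
        simp only [hp] at this
        exact_mod_cast this
      rw [List.length_eq_zero_iff.1 this]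
      exact ⟨1, by simp⟩
  obtain ⟨c, rfl⟩ := this hx
  exact ⟨c, rfl⟩

theorem eq_zero_of_mem_grading_neg {n : ℕ} {x : Nilcoxeter F n} {p : ℤ × ZMod 2} (hp : p.1 < 0)
    (hx : x ∈ grading F n p) : x = 0 := by
  have : grading F n p ≤ ⊥ := Submodule.span_le.2 fun y hy => by
      obtain ⟨l, hl, rfl⟩ := hy
      have := congrArg Prod.fst hl
      simp only at this
      omega
  exact (Submodule.mem_bot F).1 (this hx)

theorem algebraMap_zero_surjective (x : Nilcoxeter F 0) : ∃ c : F, algebraMap F _ c = x := by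
  have : (Algebra.linearMap F (Nilcoxeter F 0)).range = ⊤ :=
    eq_top_of_one_mem_of_mul_mem _ ⟨1, by simp⟩ fun _ _ i => i.elim0
  exact LinearMap.range_eq_top.1 this x

instance (n : ℕ) : FiniteDimensional F (Nilcoxeter F n) := by
  obtain ⟨κ, _, c, -, hx⟩ := exists_generators (F := F) n.zero_le
  have : Module.Finite F (Nilcoxeter F 0) :=
    Module.Finite.of_surjective (Algebra.linearMap F (Nilcoxeter F 0)) algebraMap_zero_surjective
  exact Module.Finite.of_surjective (combination n.zero_le c) fun x => by
    obtain ⟨b, rfl⟩ := hx x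
    exact ⟨b, combination_apply _ _ _⟩

variable (F) in
theorem finrank_le_factorial (n : ℕ) : Module.finrank F (Nilcoxeter F n) ≤ n.factorial := by
  obtain ⟨κ, _, c, hc, hx⟩ := exists_generators (F := F) n.zero_le
  have h0 : Module.finrank F (Nilcoxeter F 0) ≤ 1 :=
    (LinearMap.finrank_le_finrank_of_surjective (f := Algebra.linearMap F (Nilcoxeter F 0))
      algebraMap_zero_surjective).trans (Module.finrank_self F).le
  have h1 := LinearMap.finrank_le_finrank_of_surjective (f := combination n.zero_le c) fun x => by
    obtain ⟨b, rfl⟩ := hx x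
    exact ⟨b, combination_apply _ _ _⟩
  rw [Module.finrank_pi_fintype, Finset.sum_const, Finset.card_univ, smul_eq_mul] at h1
  rw [Nat.factorial_zero, mul_one] at hc
  rw [← hc]
  exact h1.trans (mul_le_of_le_one_right (Nat.zero_le _) h0)

/-! ### The representation on functions on the symmetric group, and the trace. -/

variable {n : ℕ}

/-- The first of the two positions exchanged by the `i`-th simple transposition. -/
def lo (i : Fin (n - 1)) : Fin n := ⟨i, by omega⟩

/-- The second of the two positions exchanged by the `i`-th simple transposition. -/
def hi (i : Fin (n - 1)) : Fin n := ⟨i + 1, by omega⟩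

/-- The `i`-th simple transposition. -/
def simple (i : Fin (n - 1)) : Equiv.Perm (Fin n) := Equiv.swap (lo i) (hi i)

theorem lo_lt_hi (i : Fin (n - 1)) : lo i < hi i := Nat.lt_succ_self _

theorem simple_lo (i : Fin (n - 1)) : simple i (lo i) = hi i := Equiv.swap_apply_left _ _

theorem simple_hi (i : Fin (n - 1)) : simple i (hi i) = lo i := Equiv.swap_apply_right _ _

theorem simple_mul_self (i : Fin (n - 1)) : simple i * simple i = 1 := Equiv.swap_mul_self _ _

theorem simple_inv (i : Fin (n - 1)) : (simple i)⁻¹ = simple i := Equiv.swap_inv _ _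

theorem simple_of_ne {i : Fin (n - 1)} {p : Fin n} (h1 : p ≠ lo i) (h2 : p ≠ hi i) :
    simple i p = p := Equiv.swap_apply_of_ne_of_ne h1 h2

/-- A simple transposition only changes the relative order of the two points it exchanges. -/
theorem simple_lt_simple_iff (i : Fin (n - 1)) {p q : Fin n}
    (h1 : ¬(p = lo i ∧ q = hi i)) (h2 : ¬(p = hi i ∧ q = lo i)) :
    simple i p < simple i q ↔ p < q := by
  simp only [simple, Equiv.swap_apply_def]
  simp only [lo, hi, Fin.ext_iff] at h1 h2 ⊢
  simp only [Fin.lt_def]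
  split_ifs <;> simp only <;> omega

/-- The action of `u_i` on functions on the symmetric group. -/
def act (i : Fin (n - 1)) : Module.End F (Equiv.Perm (Fin n) → F) where
  toFun φ w := if w (hi i) < w (lo i) then φ (w * simple i) else 0
  map_add' φ χ := by ext w; simp only [Pi.add_apply]; split_ifs <;> simp
  map_smul' c φ := by ext w; simp

theorem act_apply (i : Fin (n - 1)) (φ : Equiv.Perm (Fin n) → F) (w : Equiv.Perm (Fin n)) :
    act i φ w = if w (hi i) < w (lo i) then φ (w * simple i) else 0 := rfl

theorem act_sq (i : Fin (n - 1)) : act (F := F) i * act i = 0 := by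
  refine LinearMap.ext fun φ => funext fun w => ?_
  simp only [Module.End.mul_apply, act_apply, Equiv.Perm.mul_apply, simple_lo, simple_hi,
    LinearMap.zero_apply, Pi.zero_apply]
  split_ifs with h1 h2
  · exact absurd h1 h2.asymm
  · rfl
  · rfl

theorem act_comm (i j : Fin (n - 1)) (h : i.val + 1 < j.val ∨ j.val + 1 < i.val) :
    act (F := F) i * act j = act j * act i := by
  have h1 : simple i (lo j) = lo j := simple_of_ne (by simp [lo, Fin.ext_iff]; omega)
    (by simp [lo, hi, Fin.ext_iff]; omega)
  have h2 : simple i (hi j) = hi j := simple_of_ne (by simp [lo, hi, Fin.ext_iff]; omega)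
    (by simp [hi, Fin.ext_iff]; omega)
  have h3 : simple j (lo i) = lo i := simple_of_ne (by simp [lo, Fin.ext_iff]; omega)
    (by simp [lo, hi, Fin.ext_iff]; omega)
  have h4 : simple j (hi i) = hi i := simple_of_ne (by simp [lo, hi, Fin.ext_iff]; omega)
    (by simp [hi, Fin.ext_iff]; omega)
  have hs : simple i * simple j = simple j * simple i := by
    rw [← mul_inv_eq_iff_eq_mul]
    nth_rw 2 [simple]
    rw [← Equiv.swap_apply_apply, h1, h2, simple]
  refine LinearMap.ext fun φ => funext fun w => ?_
  simp only [Module.End.mul_apply, act_apply, Equiv.Perm.mul_apply, h1, h2, h3, h4, mul_assoc, hs]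
  split_ifs <;> rfl

theorem act_braid (i j : Fin (n - 1)) (h : i.val + 1 = j.val) :
    act (F := F) i * act j * act i = act j * act i * act j := by
  have hij : hi i = lo j := Fin.ext h
  have h1 : simple i (hi j) = hi j := simple_of_ne (by simp [lo, hi, Fin.ext_iff]; omega)
    (by simp [hi, Fin.ext_iff]; omega)
  have h2 : simple j (lo i) = lo i := simple_of_ne (by simp [lo, Fin.ext_iff]; omega)
    (by simp [lo, hi, Fin.ext_iff]; omega)
  have h3 : simple i (lo j) = lo i := hij ▸ simple_hi i
  have h4 : simple j (hi i) = hi j := hij ▸ simple_lo j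
  have hs : simple i * (simple j * simple i) = simple j * (simple i * simple j) := by
    have e1 : simple i * simple j * (simple i)⁻¹ = Equiv.swap (lo i) (hi j) := by
      nth_rw 2 [simple]
      rw [← Equiv.swap_apply_apply, h3, h1]
    have e2 : simple j * simple i * (simple j)⁻¹ = Equiv.swap (lo i) (hi j) := by
      nth_rw 2 [simple]
      rw [← Equiv.swap_apply_apply, h2, h4]
    rw [simple_inv] at e1 e2
    rw [← mul_assoc, ← mul_assoc, e1, e2]
  refine LinearMap.ext fun φ => funext fun w => ?_
  simp only [Module.End.mul_apply, act_apply, Equiv.Perm.mul_apply, h1, h2, h4, mul_assoc, hs,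
    simple_lo, simple_hi, ← hij]
  split_ifs <;> rfl

/-- The representation of `N_n` on functions on the symmetric group. -/
def rep (n : ℕ) : Nilcoxeter F n →ₐ[F] Module.End F (Equiv.Perm (Fin n) → F) :=
  lift act act_sq act_comm act_braid

theorem rep_u (i : Fin (n - 1)) : rep n (u F n i) = act i := lift_u _ _ _ _ _

/-- The right action of `u_j` on functions on the symmetric group. -/
def ract (j : Fin (n - 1)) : Module.End F (Equiv.Perm (Fin n) → F) where
  toFun φ w := if w⁻¹ (hi j) < w⁻¹ (lo j) then φ (simple j * w) else 0
  map_add' φ χ := by ext w; simp only [Pi.add_apply]; split_ifs <;> simp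
  map_smul' c φ := by ext w; simp

theorem ract_apply (i : Fin (n - 1)) (φ : Equiv.Perm (Fin n) → F) (w : Equiv.Perm (Fin n)) :
    ract i φ w = if w⁻¹ (hi i) < w⁻¹ (lo i) then φ (simple i * w) else 0 := rfl

/-- If `w` carries the positions of `i` to those of `j`, in either order, then `w s_i = s_j w` and
both composites vanish at `w`. Otherwise neither transposition affects the inversion condition of
the other. -/
theorem act_mul_ract (i j : Fin (n - 1)) : act (F := F) i * ract j = ract j * act i := by
  refine LinearMap.ext fun φ => funext fun w => ?_
  simp only [Module.End.mul_apply, act_apply, ract_apply, mul_inv_rev, simple_inv,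
    Equiv.Perm.mul_apply, mul_assoc]
  by_cases h1 : w (lo i) = lo j ∧ w (hi i) = hi j
  · have h2 : w⁻¹ (lo j) = lo i := by rw [Equiv.Perm.inv_eq_iff_eq, h1.1]
    have h3 : w⁻¹ (hi j) = hi i := by rw [Equiv.Perm.inv_eq_iff_eq, h1.2]
    simp [h1.1, h1.2, h2, h3, (lo_lt_hi _).asymm]
  by_cases h1' : w (hi i) = lo j ∧ w (lo i) = hi j
  · have h2 : w⁻¹ (lo j) = hi i := by rw [Equiv.Perm.inv_eq_iff_eq, h1'.1]
    have h3 : w⁻¹ (hi j) = lo i := by rw [Equiv.Perm.inv_eq_iff_eq, h1'.2]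
    simp [h1'.1, h1'.2, h2, h3, simple_lo, simple_hi, (lo_lt_hi _).asymm]
  have e1 : simple i (w⁻¹ (hi j)) < simple i (w⁻¹ (lo j)) ↔ w⁻¹ (hi j) < w⁻¹ (lo j) := by
    refine simple_lt_simple_iff i ?_ ?_ <;> rintro ⟨a, b⟩ <;>
      rw [Equiv.Perm.inv_eq_iff_eq] at a b
    exacts [h1' ⟨b.symm, a.symm⟩, h1 ⟨b.symm, a.symm⟩]
  have e2 : simple j (w (hi i)) < simple j (w (lo i)) ↔ w (hi i) < w (lo i) :=
    simple_lt_simple_iff j h1' fun h => h1 ⟨h.2, h.1⟩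
  simp only [e1, e2]
  split_ifs <;> rfl

theorem rep_mul_ract (x : Nilcoxeter F n) (j : Fin (n - 1)) :
    rep n x * ract j = ract j * rep n x := by
  have h : (Subalgebra.centralizer F {ract (F := F) j}).comap (rep n) = ⊤ := by
    rw [← Algebra.toSubmodule_eq_top]
    refine eq_top_of_one_mem_of_mul_mem _ (Subalgebra.one_mem _) fun x hx i => ?_
    refine Subalgebra.mul_mem _ hx ?_
    rw [Subalgebra.mem_comap, rep_u, Subalgebra.mem_centralizer_iff]
    rintro _ rfl
    exact (act_mul_ract i j).symm
  have hx : x ∈ (Subalgebra.centralizer F {ract (F := F) j}).comap (rep n) := h ▸ trivial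
  exact (Subalgebra.mem_centralizer_iff F |>.1 hx _ rfl).symm

/-- The indicator function of the identity permutation. -/
def deltaOne : Equiv.Perm (Fin n) → F := Pi.single 1 1

/-- Both sides are the indicator of `s_j`. This lets a rightmost factor `u_j` of an algebra element
be traded for the commuting right action. -/
theorem act_deltaOne (j : Fin (n - 1)) : act j (deltaOne (F := F)) = ract j deltaOne := by
  ext w
  rw [act_apply, ract_apply]
  by_cases h : w = simple j
  · subst h
    simp [simple_inv, simple_lo, simple_hi]
  · have h1 : w * simple j ≠ 1 := fun h' =>
      h (by rw [← simple_inv]; exact eq_inv_of_mul_eq_one_left h')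
    have h2 : simple j * w ≠ 1 := fun h' =>
      h (by rw [← simple_inv]; exact eq_inv_of_mul_eq_one_right h')
    simp [deltaOne, h1, h2]

variable (F n) in
/-- The trace of `N_n`: the coefficient of the longest element. -/
def trace : Nilcoxeter F n →ₗ[F] F :=
  LinearMap.proj Fin.revPerm ∘ₗ LinearMap.applyₗ deltaOne ∘ₗ (rep n).toLinearMap

theorem trace_apply (x : Nilcoxeter F n) : trace F n x = rep n x deltaOne Fin.revPerm := rfl

/-- The right action of `u_j` at `w₀` evaluates at `s_j w₀`, the left action of `u_{n-j}` at `w₀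
s_{n-j}`, and these permutations agree. Both inversion conditions hold because `w₀` reverses every
pair. -/
theorem trace_mul_u (x : Nilcoxeter F n) (j : Fin (n - 1)) :
    trace F n (x * u F n j) = trace F n (u F n j.rev * x) := by
  rw [trace_apply, trace_apply, map_mul, map_mul, rep_u, rep_u, Module.End.mul_apply,
    act_deltaOne, ← Module.End.mul_apply, rep_mul_ract, Module.End.mul_apply, Module.End.mul_apply,
    ract_apply, act_apply]
  have h1 : (lo j).rev = hi j.rev := by simp [lo, hi, Fin.ext_iff]; omega
  have h2 : (hi j).rev = lo j.rev := by simp [lo, hi, Fin.ext_iff]; omega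
  have h3 : simple j * Fin.revPerm = Fin.revPerm * simple j.rev := by
    rw [← inv_mul_eq_iff_eq_mul]
    have hinv : (Fin.revPerm (n := n))⁻¹ * simple j * (Fin.revPerm)⁻¹⁻¹ = simple j.rev := by
      rw [simple, ← Equiv.swap_apply_apply, Equiv.swap_comm, simple, ← h1, ← h2]
      rfl
    rwa [inv_inv, mul_assoc] at hinv
  have hr : (Fin.revPerm (n := n))⁻¹ = Fin.revPerm := Fin.revPerm_symm
  rw [h3, hr]
  simp only [Fin.revPerm_apply, Fin.rev_lt_rev, lo_lt_hi, if_true]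

theorem strictMono_of_forall_lo_hi {w : Fin n → Fin n} (h : ∀ i, w (lo i) < w (hi i)) :
    StrictMono w := by
  cases n with
  | zero => exact fun i => i.elim0
  | succ n => exact Fin.strictMono_iff_lt_succ.2 h

theorem eq_one_of_strictMono {w : Equiv.Perm (Fin n)} (h : StrictMono w) : w = 1 :=
  Equiv.coe_fn_injective <| (h.range_inj strictMono_id).1 (by
    rw [w.surjective.range_eq, Set.range_id])

/-- Induction on the one-line notation in lexicographic order: removing a descent lowers it, and a
permutation without descents is the identity. -/
theorem exists_rep_deltaOne (w : Equiv.Perm (Fin n)) :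
    ∃ a, rep n a deltaOne = (Pi.single w 1 : _ → F) := by
  obtain ⟨f, hf⟩ : ∃ f : Lex (Fin n → Fin n), f = toLex ⇑w := ⟨_, rfl⟩
  induction f using WellFoundedLT.induction generalizing w with
  | ind f ih =>
  subst hf
  by_cases h : ∃ i, w (hi i) < w (lo i)
  · obtain ⟨i, hi'⟩ := h
    obtain ⟨a, ha⟩ := ih _ (Pi.lex_desc (lo_lt_hi i).le hi') (w * simple i) rfl
    refine ⟨u F n i * a, ?_⟩
    rw [map_mul, rep_u, Module.End.mul_apply, ha]
    ext v
    rw [act_apply]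
    by_cases hv : v = w
    · subst hv; simp [hi']
    · simp [hv]
  · push Not at h
    have h1 : StrictMono w := strictMono_of_forall_lo_hi fun i =>
      (h i).lt_of_ne (w.injective.ne (lo_lt_hi i).ne)
    have : w = 1 := eq_one_of_strictMono h1
    exact ⟨1, by rw [this]; simp [deltaOne]⟩

/-- The dual induction, on the complemented one-line notation: ascents are turned into descents
until `w₀` is reached. This is what makes the trace nondegenerate. -/
theorem exists_rep_apply_revPerm (w : Equiv.Perm (Fin n)) :
    ∃ a : Nilcoxeter F n, ∀ φ, rep n a φ Fin.revPerm = φ w := by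
  obtain ⟨f, hf⟩ : ∃ f : Lex (Fin n → Fin n), f = toLex (fun i => (w i).rev) := ⟨_, rfl⟩
  induction f using WellFoundedLT.induction generalizing w with
  | ind f ih =>
  subst hf
  by_cases h : ∃ i, w (lo i) < w (hi i)
  · obtain ⟨i, hi'⟩ := h
    obtain ⟨a, ha⟩ := ih _ (Pi.lex_desc (lo_lt_hi i).le (f := fun i => (w i).rev)
      (Fin.rev_lt_rev.2 hi')) (w * simple i) rfl
    refine ⟨a * u F n i, fun φ => ?_⟩
    rw [map_mul, rep_u, Module.End.mul_apply, ha, act_apply]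
    simp [simple_lo, simple_hi, hi', mul_assoc, simple_mul_self]
  · push Not at h
    have h1 : StrictMono ⇑(Fin.revPerm * w : Equiv.Perm (Fin n)) :=
      strictMono_of_forall_lo_hi fun i => by
        simpa using (h i).lt_of_ne (w.injective.ne (lo_lt_hi i).ne')
    have : w = Fin.revPerm :=
      (eq_inv_of_mul_eq_one_right (eq_one_of_strictMono h1)).trans Fin.revPerm_symm
    exact ⟨1, by rw [this]; simp⟩

/-- Surjectivity comes from reaching every indicator; the spanning set bounds the dimension of `N_n`
by `n!`, which forces injectivity. -/
theorem rep_deltaOne_bijective :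
    Function.Bijective fun x : Nilcoxeter F n => rep n x deltaOne := by
  let L : Nilcoxeter F n →ₗ[F] (Equiv.Perm (Fin n) → F) :=
    LinearMap.applyₗ deltaOne ∘ₗ (rep n).toLinearMap
  have hs : Function.Surjective L := by
    rw [← LinearMap.range_eq_top, eq_top_iff, ← (Pi.basisFun F (Equiv.Perm (Fin n))).span_eq,
      Submodule.span_le]
    rintro _ ⟨w, rfl⟩
    obtain ⟨a, ha⟩ := exists_rep_deltaOne (F := F) w
    exact ⟨a, by rw [Pi.basisFun_apply, ← ha]; rfl⟩
  have hd : Module.finrank F (Nilcoxeter F n) = Module.finrank F (Equiv.Perm (Fin n) → F) := by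
    refine le_antisymm ?_ (LinearMap.finrank_le_finrank_of_surjective hs)
    rw [Module.finrank_fintype_fun_eq_card, Fintype.card_perm, Fintype.card_fin]
    exact finrank_le_factorial F n
  exact ⟨(LinearMap.injective_iff_surjective_of_finrank_eq_finrank hd).2 hs, hs⟩

variable (F) in
theorem finrank_eq_factorial (n : ℕ) : Module.finrank F (Nilcoxeter F n) = n.factorial := by
  let L : Nilcoxeter F n →ₗ[F] (Equiv.Perm (Fin n) → F) :=
    LinearMap.applyₗ deltaOne ∘ₗ (rep n).toLinearMap
  rw [(LinearEquiv.ofBijective L rep_deltaOne_bijective).finrank_eq,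
    Module.finrank_fintype_fun_eq_card, Fintype.card_perm, Fintype.card_fin]

theorem eq_zero_of_trace_mul {x : Nilcoxeter F n} (h : ∀ a, trace F n (a * x) = 0) : x = 0 := by
  apply rep_deltaOne_bijective.1
  ext w
  obtain ⟨a, ha⟩ := exists_rep_apply_revPerm (F := F) w
  have := h a
  rw [trace_apply, map_mul, Module.End.mul_apply, ha] at this
  simpa using this

end Representation

/-! ### Inversions, homogeneity of the trace, and the Nakayama automorphism. -/

section Length

variable {F : Type*} [Field F] {n : ℕ}

/-- The inversions of a permutation. -/
def inversions (w : Equiv.Perm (Fin n)) : Finset (Fin n × Fin n) :=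
  Finset.univ.filter fun p => p.1 < p.2 ∧ w p.2 < w p.1

theorem mem_inversions {w : Equiv.Perm (Fin n)} {p q : Fin n} :
    (p, q) ∈ inversions w ↔ p < q ∧ w q < w p := by simp [inversions]

/-- The pair `(lo i, hi i)` stops being an inversion, and `s_i` carries the remaining inversions of
`w` bijectively to those of `w s_i`. -/
theorem card_inversions_mul_simple {w : Equiv.Perm (Fin n)} {i : Fin (n - 1)}
    (h : w (hi i) < w (lo i)) :
    (inversions w).card = (inversions (w * simple i)).card + 1 := by
  have hss : ∀ p, simple i (simple i p) = p := fun p => by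
    rw [← Equiv.Perm.mul_apply, simple_mul_self, Equiv.Perm.one_apply]
  have key : inversions w = insert (lo i, hi i)
      ((inversions (w * simple i)).map ((simple i).prodCongr (simple i)).toEmbedding) := by
    ext ⟨p, q⟩
    have hmap : (p, q) ∈ (inversions (w * simple i)).map
        ((simple i).prodCongr (simple i)).toEmbedding ↔
        (simple i p, simple i q) ∈ inversions (w * simple i) := by
      rw [Finset.mem_map_equiv]
      rfl
    rw [Finset.mem_insert, hmap, mem_inversions, mem_inversions]
    simp only [Equiv.Perm.mul_apply, hss, Prod.mk.injEq]
    by_cases h1 : p = lo i ∧ q = hi i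
    · simp [h1.1, h1.2, lo_lt_hi, h]
    by_cases h2 : p = hi i ∧ q = lo i
    · simp [h2.1, h2.2, lo_lt_hi, (lo_lt_hi i).asymm, (lo_lt_hi i).ne', h.asymm, simple_hi,
        simple_lo]
    rw [simple_lt_simple_iff i h1 h2]
    simp [h1]
  rw [key, Finset.card_insert_of_notMem, Finset.card_map]
  rw [Finset.mem_map_equiv]
  change (simple i (lo i), simple i (hi i)) ∉ _
  rw [simple_lo, simple_hi, mem_inversions]
  exact fun h' => (lo_lt_hi i).asymm h'.1

theorem card_inversions_revPerm : (inversions (Fin.revPerm (n := n))).card = n.choose 2 := by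
  have h1 : inversions (Fin.revPerm (n := n)) =
      (Finset.univ.sigma (fun q : Fin n => Finset.Iio q)).map
        ((Equiv.sigmaEquivProd _ _).trans (Equiv.prodComm _ _)).toEmbedding := by
    ext ⟨p, q⟩
    rw [mem_inversions, Finset.mem_map_equiv]
    simp
  rw [h1, Finset.card_map, Finset.card_sigma]
  simp only [Fin.card_Iio]
  rw [Fin.sum_univ_eq_sum_range (fun i => i), Finset.sum_range_id, Nat.choose_two_right]

theorem length_eq_of_rep_ne_zero (l : List (Fin (n - 1))) (w : Equiv.Perm (Fin n))
    (h : rep n (l.map (u F n)).prod deltaOne w ≠ 0) : l.length = (inversions w).card := by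
  induction l generalizing w with
  | nil =>
    have hw : w = 1 := by
      by_contra hw
      simp [deltaOne, hw] at h
    subst hw
    rw [List.length_nil, eq_comm, Finset.card_eq_zero, Finset.eq_empty_iff_forall_notMem]
    rintro ⟨p, q⟩ hpq
    obtain ⟨h1, h2⟩ := mem_inversions.1 hpq
    exact h1.asymm h2
  | cons i l ih =>
    rw [List.map_cons, List.prod_cons, map_mul, rep_u, Module.End.mul_apply, act_apply] at h
    split_ifs at h with hd
    · rw [List.length_cons, ih _ h, card_inversions_mul_simple hd]
    · exact absurd rfl h

variable (F n) in
theorem isFrobeniusTrace_trace : GradedSuper.IsFrobeniusTrace (grading F n)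
    (-(n.choose 2 : ℤ), (n.choose 2 : ZMod 2)) (trace F n) where
  finite := inferInstance
  homogeneous p a ha hp := by
    have : grading F n p ≤ LinearMap.ker (trace F n) := Submodule.span_le.2 fun y hy => by
      obtain ⟨l, hl, rfl⟩ := hy
      by_contra h
      have := length_eq_of_rep_ne_zero l _ h
      rw [card_inversions_revPerm] at this
      apply hp
      rw [← hl, this, Prod.mk_add_mk, CharTwo.add_self_eq_zero, neg_add_cancel]
      rfl
    exact this ha
  nondegenerate I hI := (Submodule.eq_bot_iff I).2 fun x hx =>
    eq_zero_of_trace_mul fun a => hI _ (I.mul_mem_left a hx)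

theorem neg_one_pow_smul {M : Type*} [AddCommGroup M] [Module F M] (k : ℕ) (x : M) :
    ((-1 : F) ^ k) • x = ((-1 : ℤˣ) ^ (k : ZMod 2)) • x := by
  rw [uzpow_natCast]
  rcases Nat.even_or_odd k with h | h
  · rw [h.neg_one_pow, h.neg_one_pow, one_smul, one_smul]
  · rw [h.neg_one_pow, h.neg_one_pow, neg_smul, one_smul, Units.neg_smul, one_smul]

theorem nakayama_mem_grading {p : ℤ × ZMod 2} {x : Nilcoxeter F n} (hx : x ∈ grading F n p) :
    nakayama F n x ∈ grading F n p :=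
  (nakayamaAut F n).map_mem' p x hx

theorem nakayama_u (i : Fin (n - 1)) :
    nakayama F n (u F n i) = ((-1 : ℤˣ) ^ ((n.choose 2 : ZMod 2) + 1)) • u F n i.rev := by
  refine (nakayamaHom_u F n i).trans ?_
  rw [neg_one_pow_smul, Nat.cast_add, Nat.cast_one]

theorem prod_mem_grading (l : List (Fin (n - 1))) :
    (l.map (u F n)).prod ∈ grading F n ((l.length : ℤ), (l.length : ZMod 2)) :=
  Submodule.subset_span ⟨l, rfl, rfl⟩

variable (F n) in
theorem isNakayama_nakayama :
    GradedSuper.IsNakayama (grading F n) (trace F n) (nakayama F n) := by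
  intro p q a₁ a₂ h₁ h₂
  induction h₁ using Submodule.span_induction with
  | mem x hx =>
    obtain ⟨l, rfl, rfl⟩ := hx
    induction l generalizing a₂ q with
    | nil => simp
    | cons i l ih =>
      simp only [List.map_cons, List.prod_cons, map_mul]
      have hm : a₂ * u F n i.rev ∈ grading F n (q + (1, 1)) :=
        SetLike.mul_mem_graded h₂ (u_mem F n _)
      have h3 := trace_mul_u ((l.map (u F n)).prod * a₂) i.rev
      rw [Fin.rev_rev] at h3
      rw [mul_assoc, ← h3, mul_assoc, ih _ _ hm, nakayama_u, smul_mul_assoc, mul_smul_comm,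
        map_zsmul_unit, ← mul_assoc, smul_smul, ← uzpow_add]
      -- The two signs agree only when the total degree is `n.choose 2`; a nonzero trace guarantees
      -- this, and otherwise both sides are zero.
      by_cases h0 : trace F n (a₂ * u F n i.rev * nakayama F n (l.map (u F n)).prod) = 0
      · rw [h0, smul_zero, smul_zero]
      · congr 2
        have hd : (-(n.choose 2 : ℤ), (n.choose 2 : ZMod 2)) + (q + (1, 1) +
            ((l.length : ℤ), (l.length : ZMod 2))) = 0 := by
          by_contra hne
          exact h0 ((isFrobeniusTrace_trace F n).trace_mul_eq_zero hm
            (nakayama_mem_grading (prod_mem_grading l)) hne)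
        have hd2 := congrArg Prod.snd hd
        simp only [Prod.snd_add, Prod.snd_zero, List.length_cons, Nat.cast_add, Nat.cast_one]
          at hd2 ⊢
        generalize (n.choose 2 : ZMod 2) = c, q.2 = q', (l.length : ZMod 2) = k at hd2 ⊢
        revert c q' k; decide
  | zero => simp
  | add x y _ _ hx hy => rw [add_mul, map_add, map_add, mul_add, map_add, hx, hy, smul_add]
  | smul c x _ hx =>
    rw [smul_mul_assoc, map_smul, map_smul, mul_smul_comm, map_smul, hx, smul_comm]

end Length

/-! ### Freeness of `N_n` over `N_m`, and the positive statement. -/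

section Extension

variable (F : Type*) [Field F] {m n : ℕ}

theorem incl_apply (h : m ≤ n) (b : Nilcoxeter F m) : incl F h b = inclAlgHom F h b := rfl

/-- A surjection between spaces of equal dimension, `(n! / m!) · m! = n!`. -/
theorem combination_bijective (h : m ≤ n) {κ : Type} [Fintype κ] {c : κ → Nilcoxeter F n}
    (hc : Fintype.card κ * m.factorial = n.factorial)
    (hx : ∀ x, ∃ b : κ → Nilcoxeter F m, x = ∑ k, inclAlgHom F h (b k) * c k) :
    Function.Bijective (combination h c) := by
  have hs : Function.Surjective (combination h c) := fun x => by
    obtain ⟨b, rfl⟩ := hx x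
    exact ⟨b, combination_apply _ _ _⟩
  refine ⟨(LinearMap.injective_iff_surjective_of_finrank_eq_finrank ?_).2 hs, hs⟩
  rw [Module.finrank_pi_fintype, Finset.sum_const, Finset.card_univ, smul_eq_mul,
    finrank_eq_factorial, finrank_eq_factorial, hc]

/-- `N_n` is a free left `N_m`-module of finite rank. -/
theorem exists_equiv_pi (h : m ≤ n) :
    letI : Module (Nilcoxeter F m) (Nilcoxeter F n) :=
      Module.compHom (Nilcoxeter F n) (incl F h : Nilcoxeter F m →+* Nilcoxeter F n)
    ∃ (κ : Type) (_ : Fintype κ),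
      Nonempty κ ∧ Nonempty ((κ → Nilcoxeter F m) ≃ₗ[Nilcoxeter F m] Nilcoxeter F n) := by
  let _ : Module (Nilcoxeter F m) (Nilcoxeter F n) :=
    Module.compHom (Nilcoxeter F n) (incl F h : Nilcoxeter F m →+* Nilcoxeter F n)
  obtain ⟨κ, _, c, hc, hx⟩ := exists_generators (F := F) h
  have hb := combination_bijective F h hc hx
  refine ⟨κ, inferInstance, ?_, ⟨LinearEquiv.ofBijective
    { toFun := combination h c
      map_add' := map_add _
      map_smul' := fun b x => ?_ } hb⟩⟩
  · rw [← Fintype.card_pos_iff]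
    exact Nat.pos_of_mul_pos_right (hc ▸ n.factorial_pos)
  · change _ = inclAlgHom F h b * _
    rw [combination_apply, combination_apply, Finset.mul_sum]
    refine Finset.sum_congr rfl fun k _ => ?_
    rw [Pi.smul_apply, smul_eq_mul, map_mul, mul_assoc]

theorem incl_injective (h : m ≤ n) : Function.Injective (incl F h) := by
  let _ : Module (Nilcoxeter F m) (Nilcoxeter F n) :=
    Module.compHom (Nilcoxeter F n) (incl F h : Nilcoxeter F m →+* Nilcoxeter F n)
  obtain ⟨κ, _, ⟨k⟩, ⟨e⟩⟩ := exists_equiv_pi F h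
  refine (injective_iff_map_eq_zero _).2 fun b hb => ?_
  have h1 : e (b • fun _ => 1) = 0 := by
    rw [map_smul]
    change incl F h b * _ = 0
    rw [hb, zero_mul]
  simpa using congrFun (e.map_eq_zero_iff.1 h1) k

theorem isTwistedFrobeniusExtension (h : m ≤ n) :
    GradedSuper.IsTwistedFrobeniusExtension (grading F n) (grading F m)
      (incl F h) (nakayamaAut F n) (nakayamaAut F m)
      ((m.choose 2 : ℤ) - (n.choose 2 : ℤ), (m.choose 2 : ZMod 2) + (n.choose 2 : ZMod 2)) where
  injective := incl_injective F h
  finite := by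
    obtain ⟨κ, _, -, ⟨e⟩⟩ := exists_equiv_pi F h
    let _ : Module (Nilcoxeter F m) (Nilcoxeter F n) :=
      Module.compHom (Nilcoxeter F n) (incl F h : Nilcoxeter F m →+* Nilcoxeter F n)
    exact Module.Finite.equiv e
  projective := by
    obtain ⟨κ, _, -, ⟨e⟩⟩ := exists_equiv_pi F h
    let _ : Module (Nilcoxeter F m) (Nilcoxeter F n) :=
      Module.compHom (Nilcoxeter F n) (incl F h : Nilcoxeter F m →+* Nilcoxeter F n)
    exact Module.Projective.of_equiv e
  exists_iso := (isFrobeniusTrace_trace F n).exists_iso (isFrobeniusTrace_trace F m) (incl F h)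
    (fun c b => map_smul (inclAlgHom F h) c b) (nakayamaAut F n) (nakayamaAut F m)
    (fun c b => map_smul (nakayama F m) c b)
    (isNakayama_nakayama F n) (isNakayama_nakayama F m) _ (by
      rw [Prod.mk_sub_mk, CharTwo.sub_eq_add (n.choose 2 : ZMod 2), add_comm (m.choose 2 : ZMod 2),
        neg_sub_neg])

end Extension

/-! ### Impossibility with trivial twist on `N_n`. -/

section Obstruction

variable (F : Type*) [Field F] {m n : ℕ}

/-- The homomorphism from `N_n` to the dual numbers killing all generators but the last one. -/
def lastHom (n : ℕ) : Nilcoxeter F n →ₐ[F] DualNumber F :=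
  lift (fun i => if i.val + 2 = n then DualNumber.eps else 0)
    (fun i => by split_ifs <;> simp)
    (fun i j h => by split_ifs <;> simp)
    (fun i j h => by split_ifs <;> simp)

/-- The map to the dual numbers takes `N_m` into the scalars, since `m < n`, but takes `u_{n-1}` to
`ε`. -/
theorem u_notMem_range_incl (h : m < n) (i : Fin (n - 1)) (hin : i.val + 2 = n)
    (b : Nilcoxeter F m) : u F n i ≠ incl F h.le b := by
  intro hu
  have h1 : (lastHom F n).comp (inclAlgHom F h.le) =
      (Algebra.ofId F (DualNumber F)).comp
        (lift (fun _ => 0) (by simp) (by simp) (by simp)) := by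
    refine hom_ext fun j => ?_
    rw [AlgHom.comp_apply, AlgHom.comp_apply, inclAlgHom, lift_u, lift_u, lastHom, lift_u, map_zero,
      if_neg]
    have := j.2
    simp only [Fin.val_castLE]
    omega
  have h2 := congrArg (lastHom F n) hu
  rw [incl_apply, ← AlgHom.comp_apply, h1, lastHom, lift_u, if_pos hin] at h2
  have h3 := congrArg TrivSqZeroExt.snd h2
  simp [Algebra.ofId_apply, TrivSqZeroExt.algebraMap_eq_inl] at h3

open GradedSuper

/-- Otherwise the trace, being homogeneous, would vanish identically, and nondegeneracy would give
`1 = 0`. -/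
theorem exists_trace_ne_zero (n : ℕ) :
    ∃ a ∈ grading F n ((n.choose 2 : ℤ), (n.choose 2 : ZMod 2)), trace F n a ≠ 0 := by
  by_contra! h
  have h0 : (trace F n).toAddMonoidHom = 0 := by
    refine addMonoidHom_ext (𝒜 := grading F n) fun q x hx => ?_
    by_cases hq : q = ((n.choose 2 : ℤ), (n.choose 2 : ZMod 2))
    · subst hq; exact h x hx
    · refine (isFrobeniusTrace_trace F n).homogeneous q x hx fun h' => hq ?_
      rw [← neg_eq_iff_add_eq_zero.2 h', Prod.neg_mk, neg_neg, CharTwo.neg_eq]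
  have h1 : (1 : Nilcoxeter F n) = 0 :=
    eq_zero_of_trace_mul fun a => DFunLike.congr_fun h0 (a * 1)
  have h2 := congrArg (fun x => rep n x deltaOne 1) h1
  simp [deltaOne] at h2

/-- A linear functional on `N_n` that is homogeneous, and is not annihilated by right
multiplication by any nonzero homogeneous element, is a multiple of the trace. -/
theorem exists_eq_smul_trace (T : Nilcoxeter F n →ₗ[F] F) (d : ℤ × ZMod 2)
    (hT : ∀ q, ∀ x ∈ grading F n q, d + q ≠ 0 → T x = 0)
    (hann : ∀ p, ∀ a ∈ grading F n p, (∀ x, T (x * a) = 0) → a = 0) :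
    ∃ c : F, c ≠ 0 ∧ ∀ x, T x = c * trace F n x := by
  have hA := isFrobeniusTrace_trace F n
  set z := hA.dualEquiv.symm T
  have hTz : ∀ x, trace F n (x * z) = T x := hA.trace_mul_dualEquiv_symm T
  set t := d - (-(n.choose 2 : ℤ), (n.choose 2 : ZMod 2)) with ht
  have hzt : z ∈ grading F n t := hA.mem_of_trace_mul fun q x hx hne => by
    rw [hTz]
    refine hT q x hx fun h0 => hne ?_
    rw [← h0, ht]; abel
  obtain ⟨a, ha, ha0⟩ := exists_trace_ne_zero F n
  have hne : ¬ ∀ x, T (x * a) = 0 := fun h => ha0 (by rw [hann _ a ha h, map_zero])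
  have haz : a * z ≠ 0 := fun h => hne fun x => by rw [← hTz, mul_assoc, h, mul_zero, map_zero]
  -- If `z` had positive degree, its product with the top-degree element `a` would exceed the top
  -- degree and vanish. Hence `z` has degree zero and is a scalar.
  have ht0 : t.1 = 0 := by
    have hz0 : z ≠ 0 := fun h => haz (by rw [h, mul_zero])
    refine le_antisymm ?_ (not_lt.1 fun h => hz0 (eq_zero_of_mem_grading_neg h hzt))
    by_contra! hpos
    refine haz (hA.eq_zero_of_homogeneous_mul fun q x hx => ?_)
    rcases lt_or_ge q.1 0 with hq | hq
    · rw [eq_zero_of_mem_grading_neg hq hx, zero_mul, map_zero]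
    · refine hA.trace_mul_eq_zero hx (SetLike.mul_mem_graded ha hzt) fun h0 => ?_
      have := congrArg Prod.fst h0
      simp only [Prod.fst_add, Prod.fst_zero] at this
      omega
  obtain ⟨c, hc⟩ := grading_zero_component ht0 hzt
  refine ⟨c, ?_, fun x => ?_⟩
  · rintro rfl
    exact haz (by rw [hc, map_zero, mul_zero])
  · rw [← hTz, hc, ← Algebra.commutes, ← Algebra.smul_def, map_smul, smul_eq_mul]

theorem not_isTwistedFrobeniusExtension_id (h : m < n) (hm : 2 ≤ m)
    (β : GradedAut (grading F m)) (deg : ℤ × ZMod 2) :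
    ¬ IsTwistedFrobeniusExtension (grading F n) (grading F m) (incl F h.le)
      (GradedAut.id (grading F n)) β deg := by
  obtain ⟨ι, hι⟩ : ∃ ι, ι = incl F h.le := ⟨_, rfl⟩
  rw [← hι]
  rintro ⟨-, -, -, Φ, hΦ1, hΦ2, hΦ3⟩
  have hA := isFrobeniusTrace_trace F n
  have hB := isFrobeniusTrace_trace F m
  have hιmem : ∀ p, ∀ b ∈ grading F m p, ι b ∈ grading F n p := fun p b hb => ι.map_mem hb
  have hβmem : ∀ p, ∀ b ∈ grading F m p, β b ∈ grading F m p := β.map_mem'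
  obtain ⟨f, hf⟩ : ∃ f : Nilcoxeter F n →+ Nilcoxeter F m, f = Φ 1 := ⟨_, rfl⟩
  have hone : (1 : Nilcoxeter F n) ∈ grading F n 0 := SetLike.GradedOne.one_mem
  obtain ⟨hfdeg, hfl⟩ := hΦ1 0 1 hone
  rw [← hf] at hfdeg hfl
  have hfleft : ∀ q, ∀ b ∈ grading F m q, ∀ x,
      f (ι (β b) * x) = ((-1 : ℤˣ) ^ (deg.2 * q.2)) • (b * f x) := by
    intro q b hb x
    simpa [shiftAct] using hfl q b hb x
  have hΦf : ∀ p, ∀ a ∈ grading F n p, ∀ r, ∀ x ∈ grading F n r,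
      (Φ a : Nilcoxeter F n →+ Nilcoxeter F m) x = ((-1 : ℤˣ) ^ (p.2 * r.2)) • f (x * a) := by
    intro p a ha r x hx
    have h1 := hΦ2 p 0 r a 1 x ha hone hx
    rw [mul_one, ← hf, Prod.snd_zero, mul_zero, uzpow_zero, one_smul] at h1
    exact h1
  have hfright : ∀ p, ∀ b ∈ grading F m p, ∀ x, f (x * ι b) = f x * b := by
    intro p b hb
    refine DFunLike.congr_fun (addMonoidHom_ext (𝒜 := grading F n)
      (f := f.comp (AddMonoidHom.mulRight (ι b)))
      (g := (AddMonoidHom.mulRight b).comp f) fun r x hx => ?_)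
    change f (x * ι b) = f x * b
    have h1 := hΦ3 p 0 r b 1 x hb hone hx
    rw [one_mul, ← hf, hΦf p _ (hιmem _ _ hb) r x hx] at h1
    simpa using h1
  have hfsmul : ∀ (c : F) x, f (c • x) = c • f x := by
    intro c x
    have h1 := hfright 0 (c • 1) ((grading F m 0).smul_mem c SetLike.GradedOne.one_mem) x
    have h2 : ι (c • 1) = c • 1 := by
      rw [hι]
      exact (map_smul (inclAlgHom F h.le) c 1).trans (by rw [map_one])
    rw [h2] at h1
    simpa using h1
  let f' : Nilcoxeter F n →ₗ[F] Nilcoxeter F m := { f with map_smul' := hfsmul }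
  -- If `trace F m (f (x * a))` vanishes for all `x`, replacing `x` by `ι (β b) * x` shows `f (x *
  -- a) = 0`. So `Φ a = 0` and `a = 0`.
  obtain ⟨c, hc, hcT⟩ := exists_eq_smul_trace F (trace F m ∘ₗ f')
    ((-(m.choose 2 : ℤ), (m.choose 2 : ZMod 2)) + deg)
    (fun q x hx hne => by
      have h1 := hfdeg q x hx
      rw [shift, sub_neg_eq_add, zero_add] at h1
      refine hB.homogeneous _ _ h1 fun h0 => hne ?_
      rw [← h0, add_assoc, add_comm deg]
      rfl)
    (fun p a ha h0 => by
      have h1 : ∀ x, f (x * a) = 0 := fun x =>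
        hB.eq_zero_of_homogeneous_mul fun q b hb => by
          have h2 := congrArg (trace F m) (hfleft q b hb (x * a))
          rw [← mul_assoc, map_zsmul_unit] at h2
          have h3 : trace F m (f (ι (β b) * x * a)) = 0 := h0 _
          rw [h3] at h2
          exact (smul_eq_zero_iff_eq _).1 h2.symm
      apply Φ.injective
      rw [map_zero]
      refine Subtype.ext (addMonoidHom_ext (𝒜 := grading F n) fun r x hx => ?_)
      rw [hΦf p a ha r x hx, h1, smul_zero]
      rfl)
  replace hcT : ∀ x, trace F m (f x) = c * trace F n x := hcT
  -- Both indices stand for `u_1`, so `i.rev` and `j.rev` stand for `u_{m-1}` and `u_{n-1}`.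
  let i : Fin (m - 1) := ⟨0, by omega⟩
  let j : Fin (n - 1) := ⟨0, by omega⟩
  have hιu : ι (u F m i) = u F n j := by rw [hι]; exact lift_u _ _ _ _ _
  set v := ((-1 : ℤˣ) ^ deg.2) • β (u F m i.rev) with hv
  have hvmem : v ∈ grading F m (1, 1) :=
    (grading F m _).toAddSubgroup.zsmul_mem (hβmem _ _ (u_mem F m _)) _
  have key : ∀ x, trace F n ((u F n j.rev - ι v) * x) = 0 := by
    intro x
    have h1 := hfleft (1, 1) _ (u_mem F m i.rev) x
    have h2 : ι v = ((-1 : ℤˣ) ^ deg.2) • ι (β (u F m i.rev)) := map_zsmul_unit ι _ _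
    -- Up to `c`, the trace of `u_{n-1} x` is that of `x u_1`, hence `tr_m (f(x) u_1) = tr_m
    -- (u_{m-1} f(x))`. Left semilinearity of `f` turns this into the trace of `ι v * x`.
    have h3 : c * trace F n (ι v * x) = c * trace F n (u F n j.rev * x) := by
      rw [← trace_mul_u, ← hcT, ← hcT, ← hιu, hfright _ _ (u_mem F m i), trace_mul_u, h2,
        smul_mul_assoc, map_zsmul_unit, h1, mul_one, smul_smul, Int.units_mul_self, one_smul]
    rw [sub_mul, map_sub, mul_left_cancel₀ hc h3, sub_self]
  -- `key` has the element on the left of the product, while nondegeneracy concerns left ideals; the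
  -- Nakayama automorphism moves it to the right.
  have hzero : nakayama F n (u F n j.rev - ι v) = 0 :=
    hA.eq_zero_of_homogeneous_mul fun q x hx => by
      have h1 := isNakayama_nakayama F n _ q _ x (sub_mem (u_mem F n j.rev) (hιmem _ _ hvmem)) hx
      rw [key] at h1
      exact (smul_eq_zero_iff_eq _).1 h1.symm
  have := (nakayama F n).injective (hzero.trans (map_zero _).symm)
  refine u_notMem_range_incl F h j.rev ?_ v (hι ▸ sub_eq_zero.1 this)
  simp only [Fin.val_rev, j]
  omega

end Obstruction

end Nilcoxeter

theorem mainTheorem9 (F : Type*) [Field F] (m n : ℕ) (hmn : m < n) :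
    -- every `N_k` is a Frobenius graded superalgebra of degree `(-C(k,2), C(k,2))` with
    -- Nakayama automorphism `ψ_k`
    (∀ k : ℕ, ∃ tr : Nilcoxeter F k →ₗ[F] F,
      GradedSuper.IsFrobeniusTrace (Nilcoxeter.grading F k)
        (-(k.choose 2 : ℤ), (k.choose 2 : ZMod 2)) tr ∧
      GradedSuper.IsNakayama (Nilcoxeter.grading F k) tr (Nilcoxeter.nakayama F k)) ∧
    -- `N_n` is a `(ψ_n, ψ_m)`-Frobenius extension of `N_m`
    GradedSuper.IsTwistedFrobeniusExtension (Nilcoxeter.grading F n) (Nilcoxeter.grading F m)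
      (Nilcoxeter.incl F hmn.le) (Nilcoxeter.nakayamaAut F n) (Nilcoxeter.nakayamaAut F m)
      ((m.choose 2 : ℤ) - (n.choose 2 : ℤ), (m.choose 2 : ZMod 2) + (n.choose 2 : ZMod 2)) ∧
    -- it is not an `(id, β)`-Frobenius extension, of any degree
    (2 ≤ m → ∀ (β : GradedSuper.GradedAut (Nilcoxeter.grading F m)) (deg : ℤ × ZMod 2),
      ¬ GradedSuper.IsTwistedFrobeniusExtension (Nilcoxeter.grading F n) (Nilcoxeter.grading F m)
        (Nilcoxeter.incl F hmn.le) (GradedSuper.GradedAut.id (Nilcoxeter.grading F n)) β deg) :=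
  ⟨fun k => ⟨Nilcoxeter.trace F k, Nilcoxeter.isFrobeniusTrace_trace F k,
    Nilcoxeter.isNakayama_nakayama F k⟩,
    Nilcoxeter.isTwistedFrobeniusExtension F hmn.le,
    fun hm β deg => Nilcoxeter.not_isTwistedFrobeniusExtension_id F hmn hm β deg⟩
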